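/- Setting. Let $p\in\mathbb N$, $q\in\{1,2\}$, $M>0$, and let $\mu$ be a finite nonzero measure on $\mathbb R$ whose support is contained in some interval $[a,b]$ with $0<a\le b<\infty$. Put $h(z)=\int e^{-tz}\,\mu(dt)$. For a probability measure $Q$ on $\mathbb R^p\times\mathbb R$ let $$F^{\rm ML}(\beta;Q)=-\mathbb E\Big[YY'\,h\Big(\sum_{i=1}^p\beta_i|X_i-X_i'|^q\Big)\Big],$$ where $(X,Y),(X',Y')$ are independent with law $Q$. Let $\mathcal B=\{\beta\in\mathbb R^p:0\le\beta_i\le M \text{ for all } i\}$. For a starting point $\beta_0\in\mathcal B$, a gradient flow of $F^{\rm ML}(\cdot;Q_n)$ is a function $\widetilde\beta:[0,\infty)\to\mathbb R^p$ of the form $\widetilde\beta(t)=\beta_0+\int_0^t v(s)\,ds$ with $v$ locally integrable and $v(s)\in-\nabla F^{\rm ML}(\widetilde\beta(s);Q_n)-\mathcal N_{\mathcal B}(\widetilde\beta(s))$ for almost every $s\ge 0$, where $\mathcal N_{\mathcal B}$ is the normal cone of $\mathcal B$ (empty outside $\mathcal B$) and $Q_n$ is the empirical distribution of $n$ i.i.d.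 observations from $Q$. The maximal correlation of $W_1,W_2$ is $$\vartheta(W_1,W_2)=\sup_{g_1,g_2}\frac{\mathrm{Cov}(g_1(W_1),g_2(W_2))}{\sqrt{\mathrm{Var}(g_1(W_1))\,\mathrm{Var}(g_2(W_2))}},$$ the supremum being over measurable real functions for which both variances are finite and positive ($\vartheta=0$ if there are none). For $\beta\in\mathbb R^p$ write $\mathrm{supp}(\beta)=\{i:\beta_i\ne0\}$. Theorem. For all $M_X,M_Y\in\mathbb R$ and $v>0$ there is a constant $\kappa>0$, depending only on $p,q,M,\mu,M_X,M_Y,v$, such that the following holds. Let $Q$ be a probability measure on $\mathbb R^p\times\mathbb R$ with $\mathbb E_Q[Y]=0$, $\|X\|_\infty\le M_X$ and $|Y|\le M_Y$ almost surely, and $\mathrm{Var}_Q(X_l)\ge v$ for all $l$. Let $S\subseteq\{1,\dots,p\}$ satisfy $\mathbb E_Q[Y|X]=\mathbb E_Q[Y|X_S]$ a.s., and suppose that the empty set does not have this property (that is, $\mathbb E_Q[Y|X]$ is not a.s. constant; in particular $S\neq\emptyset$). Let $\beta_0\in\mathcal B$ have full support, $\mathrm{supp}(\beta_0)=\{1,\dots,p\}$,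 and put $\vartheta_0=\kappa\,|F^{\rm ML}(\beta_0;Q)|$. Then $\vartheta_0>0$, and if $$\vartheta(X_S,X_{S^c})\le\vartheta_0,$$ then there are constants $c,\tau>0$ and $n_0\in\mathbb N$, independent of the sample size $n$, such that for every $n\ge n_0$, with probability at least $1-e^{-cn}$, every gradient flow $\widetilde\beta$ of $F^{\rm ML}(\cdot;Q_n)$ with $\widetilde\beta(0)=\beta_0$ satisfies $$\emptyset\ne\mathrm{supp}(\widetilde\beta(t))\subseteq S\qquad\text{for all } t\ge\tau.$$ -/

import Mathlib

open MeasureTheory ProbabilityTheory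
open scoped ENNReal

noncomputable section

namespace MetricLearning

/-- The data space: a feature vector `x` with `p` real coordinates and a real response `y`. -/
abbrev Obs (p : ℕ) : Type := (Fin p → ℝ) × ℝ

/-- The finite, nonzero measure `μ` lives on a set that is bounded and bounded away from zero. -/
structure KernelMeasure (μ : Measure ℝ) : Prop where
  finite : IsFiniteMeasure μ
  ne_zero : μ ≠ 0
  support_subset : ∃ a b : ℝ, 0 < a ∧ μ.support ⊆ Set.Icc a b

/-- The function `h z = ∫ exp (-t z) μ(dt)`. -/
def kernelFun (μ : Measure ℝ) (z : ℝ) : ℝ := ∫ t, Real.exp (-(t * z)) ∂μ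

/-- The weighted norm to the power `q`, that is `∑ i, β i * |z i| ^ q`. -/
def weightedNormPow {p : ℕ} (q : ℕ) (β : EuclideanSpace ℝ (Fin p)) (z : Fin p → ℝ) : ℝ :=
  ∑ i, β i * |z i| ^ q

/-- The metric learning objective `- E [Y Y' h (‖X - X'‖_{q, β} ^ q)]`, where `(X, Y)` and
`(X', Y')` are independent with law `Q`. -/
def objective {p : ℕ} (q : ℕ) (μ : Measure ℝ) (Q : Measure (Obs p))
    (β : EuclideanSpace ℝ (Fin p)) : ℝ :=
  -∫ w : Obs p × Obs p,
    w.1.2 * w.2.2 * kernelFun μ (weightedNormPow q β (fun i => w.1.1 i - w.2.1 i)) ∂(Q.prod Q)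

/-- The empirical distribution of a sample `z 0, …, z (n - 1)`. -/
def empiricalMeasure {p n : ℕ} (z : Fin n → Obs p) : Measure (Obs p) :=
  (n : ℝ≥0∞)⁻¹ • ∑ i, Measure.dirac (z i)

/-- The feasible box `{β : 0 ≤ β i ≤ M}`. -/
def feasibleSet (p : ℕ) (M : ℝ) : Set (EuclideanSpace ℝ (Fin p)) :=
  {β | ∀ i, 0 ≤ β i ∧ β i ≤ M}

/-- The normal cone of `B` at `x`; it is empty when `x ∉ B`. -/
def normalCone {p : ℕ} (B : Set (EuclideanSpace ℝ (Fin p))) (x : EuclideanSpace ℝ (Fin p)) :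
    Set (EuclideanSpace ℝ (Fin p)) :=
  {v | x ∈ B ∧ ∀ z ∈ B, inner ℝ v (z - x) ≤ 0}

/-- `β` solves, on `[0, ∞)`, the projected gradient inclusion
`dβ/dt ∈ - ∇ F (β) - N_B (β)`, `β 0 = β₀`: it is the integral of a locally integrable function
`v` which belongs to the right-hand side at almost every time. -/
def IsGradientFlow {p : ℕ} (F : EuclideanSpace ℝ (Fin p) → ℝ)
    (B : Set (EuclideanSpace ℝ (Fin p))) (β₀ : EuclideanSpace ℝ (Fin p))
    (β : ℝ → EuclideanSpace ℝ (Fin p)) : Prop :=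
  ∃ v : ℝ → EuclideanSpace ℝ (Fin p),
    (∀ t, 0 ≤ t → IntervalIntegrable v volume 0 t) ∧
    (∀ t, 0 ≤ t → β t = β₀ + ∫ s in (0 : ℝ)..t, v s) ∧
    ∀ᵐ s ∂(volume.restrict (Set.Ici (0 : ℝ))),
      ∃ g ∈ normalCone B (β s), v s = -gradient F (β s) - g

/-- The set of indices of the nonzero coordinates. -/
def coordSupport {p : ℕ} (β : EuclideanSpace ℝ (Fin p)) : Set (Fin p) := {i | β i ≠ 0}

/-- The subvector `X_S`. -/
def subFeatures {p : ℕ} (S : Finset (Fin p)) (z : Obs p) : S → ℝ := fun i => z.1 i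

/-- `E [Y | X] = E [Y | X_S]` almost surely: `X_S` has full predictive power for `Y`. -/
def FullPredictivePower {p : ℕ} (Q : Measure (Obs p)) (S : Finset (Fin p)) : Prop :=
  Q[fun z : Obs p => z.2 | MeasurableSpace.comap (fun z : Obs p => z.1) inferInstance]
    =ᵐ[Q] Q[fun z : Obs p => z.2 | MeasurableSpace.comap (subFeatures S) inferInstance]

/-- The maximal correlation of `W₁` and `W₂`: the supremum of the correlations of `g₁ (W₁)` and
`g₂ (W₂)` over measurable `g₁`, `g₂` for which the two variances are finite and positive.
It is `0` if there are no such functions, that is, if `W₁` or `W₂` is almost surely constant. -/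
def maximalCorrelation {Ω α₁ α₂ : Type*} [MeasurableSpace Ω] [MeasurableSpace α₁]
    [MeasurableSpace α₂] (P : Measure Ω) (W₁ : Ω → α₁) (W₂ : Ω → α₂) : ℝ :=
  sSup {r : ℝ | ∃ (g₁ : α₁ → ℝ) (g₂ : α₂ → ℝ), Measurable g₁ ∧ Measurable g₂ ∧
    MemLp (fun ω => g₁ (W₁ ω)) 2 P ∧ MemLp (fun ω => g₂ (W₂ ω)) 2 P ∧
    0 < variance (fun ω => g₁ (W₁ ω)) P ∧ 0 < variance (fun ω => g₂ (W₂ ω)) P ∧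
    r = covariance (fun ω => g₁ (W₁ ω)) (fun ω => g₂ (W₂ ω)) P /
      Real.sqrt (variance (fun ω => g₁ (W₁ ω)) P * variance (fun ω => g₂ (W₂ ω)) P)}

/-- Regularity of the population distribution: `Q` is a probability measure, `Y` is centered,
`X` and `Y` are bounded by `MX` and `MY`, and every coordinate of `X` has variance at
least `v`. -/
structure RegularPopulation {p : ℕ} (Q : Measure (Obs p)) (MX MY v : ℝ) : Prop where
  prob : IsProbabilityMeasure Q
  centered : ∫ z, z.2 ∂Q = 0
  bounded_features : ∀ᵐ z ∂Q, ∀ i, |z.1 i| ≤ MX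
  bounded_response : ∀ᵐ z ∂Q, |z.2| ≤ MY
  variance_ge : ∀ i, v ≤ variance (fun z : Obs p => z.1 i) Q

end MetricLearning

end

/-!
For each scale `t`, the kernel `exp (-t * ∑ i, β i * |x i - x' i| ^ q)` is the convolution square of
a function whose Fourier transform has no zeros: a product of Gaussians if `q = 2`, of one-sided
exponentials if `q = 1`. Hence the quadratic form it defines is nonnegative, and vanishes for
positive `β` only if `E [Y | X] = 0`; so `objective β₀ < 0` at a starting point of full support.

Replacing `Y` by `E [Y | X_S]` and the law of `(X_S, X_Sᶜ)` by the product of its marginals changes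
these forms by at most a multiple of the maximal correlation `θ`. After the replacement the value
and the partial derivative in a direction `l ∉ S` have a common factor involving `X_S` only, times
the mean of `K` and of `|X_l - X_l'| ^ q * K` respectively, where `K` is the factor of the kernel
involving `X_Sᶜ` only. This gives `∂_l objective ≥ γ * (-objective) - C * θ` on the feasible box.

A gradient flow decreases the objective, so `-objective` stays bounded below along it. If `θ` is
small, each coordinate outside `S` then decreases at a uniform rate until it reaches `0`, which
happens in bounded time. The flow cannot reach `β = 0` since `objective 0 = 0`. Hoeffding's
inequality and compactness show that the objective of `Q_n` and its gradient are uniformly close to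
those of `Q`, which makes the argument apply to `Q_n`.
-/

noncomputable section

namespace MetricLearning

open Set Filter Topology

variable {p : ℕ}

/-! ### Projected gradient flows -/

section Flow

lemma feasibleSet_eq_preimage_Icc (p : ℕ) (M : ℝ) :
    feasibleSet p M = EuclideanSpace.equiv (Fin p) ℝ ⁻¹' Icc 0 (fun _ => M) := by
  ext β
  exact forall_and

lemma isCompact_feasibleSet (p : ℕ) (M : ℝ) : IsCompact (feasibleSet p M) := by
  rw [feasibleSet_eq_preimage_Icc]
  exact (EuclideanSpace.equiv (Fin p) ℝ).toHomeomorph.isCompact_preimage.2 isCompact_Icc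

lemma convex_feasibleSet (p : ℕ) (M : ℝ) : Convex ℝ (feasibleSet p M) := by
  rw [feasibleSet_eq_preimage_Icc]
  exact (convex_Icc _ _).linear_preimage (EuclideanSpace.equiv (Fin p) ℝ).toLinearMap

section Primitive

variable {E : Type*} [NormedAddCommGroup E] [NormedSpace ℝ E] {v : ℝ → E}

lemma ae_hasDerivAt_primitive [CompleteSpace E]
    (hv : ∀ t, 0 ≤ t → IntervalIntegrable v volume 0 t) (x₀ : E) :
    ∀ᵐ t, 0 ≤ t → HasDerivAt (fun t => x₀ + ∫ s in (0 : ℝ)..t, v s) (v t) t := by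
  have hn (n : ℕ) : ∀ᵐ t, t ∈ uIcc (0 : ℝ) n → ∀ c ∈ uIcc (0 : ℝ) n,
      HasDerivAt (fun x => ∫ s in c..x, v s) (v t) t :=
    (hv n n.cast_nonneg).ae_hasDerivAt_integral
  filter_upwards [ae_all_iff.2 hn] with t ht ht0
  obtain ⟨n, htn⟩ := exists_nat_ge t
  have htmem : t ∈ uIcc (0 : ℝ) n := uIcc_of_le (ht0.trans htn) ▸ ⟨ht0, htn⟩
  exact (ht n htmem 0 left_mem_uIcc).const_add x₀

lemma continuousOn_primitive_Ici (hv : ∀ t, 0 ≤ t → IntervalIntegrable v volume 0 t) (x₀ : E) :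
    ContinuousOn (fun t => x₀ + ∫ s in (0 : ℝ)..t, v s) (Ici 0) := by
  refine continuousOn_const.add fun t (ht : 0 ≤ t) => ?_
  have hcont := intervalIntegral.continuousOn_primitive_interval' (hv (t + 1) (by linarith))
    left_mem_uIcc
  rw [uIcc_of_le (by linarith)] at hcont
  refine (hcont t ⟨ht, by linarith⟩).mono_of_mem_nhdsWithin ?_
  rw [← Ici_inter_Iic]
  exact inter_mem_nhdsWithin _ (Iic_mem_nhds (by linarith))

end Primitive

variable {F : EuclideanSpace ℝ (Fin p) → ℝ} {B : Set (EuclideanSpace ℝ (Fin p))}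
  {β₀ : EuclideanSpace ℝ (Fin p)} {β v : ℝ → EuclideanSpace ℝ (Fin p)}

lemma IsGradientFlow.zero (h : IsGradientFlow F B β₀ β) : β 0 = β₀ := by
  obtain ⟨v, -, hβ, -⟩ := h
  simpa using hβ 0 le_rfl

lemma IsGradientFlow.continuousOn (h : IsGradientFlow F B β₀ β) : ContinuousOn β (Ici 0) := by
  obtain ⟨v, hv, hβ, -⟩ := h
  exact (continuousOn_primitive_Ici hv β₀).congr hβ

lemma IsGradientFlow.mem (h : IsGradientFlow F B β₀ β) (hB : IsClosed B) {t : ℝ} (ht : 0 ≤ t) :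
    β t ∈ B := by
  by_contra hmem
  have hev : ∀ᶠ s in 𝓝[≥] t, β s ∉ B :=
    ((h.continuousOn t ht).mono (Ici_subset_Ici.2 ht)).eventually (hB.isOpen_compl.mem_nhds hmem)
  obtain ⟨u, hu, hout⟩ := mem_nhdsGE_iff_exists_Ico_subset.1 hev
  obtain ⟨v, -, -, hae⟩ := h
  rw [ae_restrict_iff' measurableSet_Ici] at hae
  have hnull : volume (Ioo t u) = 0 := by
    refine measure_mono_null (fun s hs => ?_) (ae_iff.1 hae)
    intro hcone
    obtain ⟨g, hg, -⟩ := hcone (ht.trans hs.1.le)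
    exact hout ⟨hs.1.le, hs.2⟩ hg.1
  rw [Real.volume_Ioo, ENNReal.ofReal_eq_zero, sub_nonpos] at hnull
  exact hnull.not_gt hu

/-- `v` is a velocity of the projected gradient flow `β`: besides the defining inclusion, at almost
every time it is the derivative of `β` and is orthogonal to the normal vector `g` in
`v = -∇F(β) - g`. -/
structure IsFlowVelocity (F : EuclideanSpace ℝ (Fin p) → ℝ) (B : Set (EuclideanSpace ℝ (Fin p)))
    (β v : ℝ → EuclideanSpace ℝ (Fin p)) : Prop where
  intervalIntegrable : ∀ t, 0 ≤ t → IntervalIntegrable v volume 0 t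
  eq_integral : ∀ t, 0 ≤ t → β t = β 0 + ∫ s in (0 : ℝ)..t, v s
  hasDerivAt : ∀ᵐ t, 0 < t → HasDerivAt β (v t) t
  exists_normal : ∀ᵐ t, 0 < t →
    ∃ g ∈ normalCone B (β t), v t = -gradient F (β t) - g ∧ inner ℝ g (v t) = 0

lemma inner_eq_zero_of_mem_normalCone {g w : EuclideanSpace ℝ (Fin p)} {t : ℝ}
    (hg : g ∈ normalCone B (β t)) (hmem : ∀ᶠ s in 𝓝 t, β s ∈ B) (hβ : HasDerivAt β w t) :
    inner ℝ g w = 0 := by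
  have hderiv : HasDerivAt (fun s => inner ℝ g (β s - β t)) (inner ℝ g w) t := by
    simpa using (hasDerivAt_const t g).inner ℝ (hβ.sub_const (β t))
  refine IsLocalMax.hasDerivAt_eq_zero ?_ hderiv
  filter_upwards [hmem] with s hs
  simpa using hg.2 _ hs

lemma IsGradientFlow.exists_isFlowVelocity (h : IsGradientFlow F B β₀ β) (hB : IsClosed B) :
    ∃ v, IsFlowVelocity F B β v := by
  have hmem (t : ℝ) (ht : 0 ≤ t) : β t ∈ B := h.mem hB ht
  have hzero := h.zero
  obtain ⟨v, hv, hβ, hae⟩ := h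
  have hderiv : ∀ᵐ t, 0 < t → HasDerivAt β (v t) t := by
    filter_upwards [ae_hasDerivAt_primitive hv β₀] with t ht ht0
    refine (ht ht0.le).congr_of_eventuallyEq ?_
    filter_upwards [Ioi_mem_nhds ht0] with s hs using hβ s (le_of_lt hs)
  refine ⟨v, hv, hzero ▸ hβ, hderiv, ?_⟩
  rw [ae_restrict_iff' measurableSet_Ici] at hae
  filter_upwards [hae, hderiv] with t hcone ht ht0
  obtain ⟨g, hg, hvg⟩ := hcone ht0.le
  refine ⟨g, hg, hvg, inner_eq_zero_of_mem_normalCone hg ?_ (ht ht0)⟩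
  filter_upwards [Ioi_mem_nhds ht0] with s hs using hmem s (le_of_lt hs)

lemma continuous_gradient_of_contDiff (hF : ContDiff ℝ 1 F) : Continuous (gradient F) :=
  (InnerProductSpace.toDual ℝ _).symm.continuous.comp (hF.continuous_fderiv one_ne_zero)

lemma IsFlowVelocity.inner_gradient (h : IsFlowVelocity F B β v) :
    ∀ᵐ t, 0 < t → inner ℝ (gradient F (β t)) (v t) = -‖v t‖ ^ 2 := by
  filter_upwards [h.exists_normal] with t ht ht0
  obtain ⟨g, -, hvg, horth⟩ := ht ht0
  have hgrad : gradient F (β t) = -v t - g := by rw [hvg]; abel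
  rw [hgrad, inner_sub_left, inner_neg_left, horth, real_inner_self_eq_norm_sq, sub_zero]

lemma IsFlowVelocity.norm_le (h : IsFlowVelocity F B β v) :
    ∀ᵐ t, 0 < t → ‖v t‖ ≤ ‖gradient F (β t)‖ := by
  filter_upwards [h.inner_gradient] with t ht ht0
  have hcs := abs_real_inner_le_norm (gradient F (β t)) (v t)
  rw [ht ht0, abs_neg, abs_of_nonneg (by positivity), sq] at hcs
  rcases (norm_nonneg (v t)).eq_or_lt' with hv | hv
  · exact hv ▸ norm_nonneg _
  · exact le_of_mul_le_mul_right hcs hv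

lemma IsFlowVelocity.lipschitzOnWith (h : IsFlowVelocity F B β v) {C : NNReal}
    (hC : ∀ t, 0 ≤ t → ‖gradient F (β t)‖ ≤ C) : LipschitzOnWith C β (Ici 0) := by
  refine LipschitzOnWith.of_dist_le_mul fun x hx y hy => ?_
  rw [dist_eq_norm, h.eq_integral x hx, h.eq_integral y hy, add_sub_add_left_eq_sub,
    intervalIntegral.integral_interval_sub_left (h.intervalIntegrable x hx)
      (h.intervalIntegrable y hy), Real.dist_eq]
  refine intervalIntegral.norm_integral_le_of_norm_le_const_ae ?_
  filter_upwards [h.norm_le] with s hs hsxy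
  have hs0 : 0 < s := (le_min hy hx).trans_lt hsxy.1
  exact (hs hs0).trans (hC s hs0.le)

lemma IsFlowVelocity.deriv_comp_nonpos (h : IsFlowVelocity F B β v) (hF : Differentiable ℝ F) :
    ∀ᵐ t, 0 < t → deriv (F ∘ β) t ≤ 0 := by
  filter_upwards [h.hasDerivAt, h.inner_gradient] with t hderiv hinner ht0
  have hcomp := (hF (β t)).hasGradientAt.hasFDerivAt.comp_hasDerivAt t (hderiv ht0)
  rw [hcomp.deriv, InnerProductSpace.toDual_apply_apply, hinner ht0]
  exact neg_nonpos.2 (sq_nonneg _)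

lemma IsGradientFlow.objective_le (h : IsGradientFlow F B β₀ β) (hB : IsCompact B)
    (hBc : Convex ℝ B) (hF : ContDiff ℝ 1 F) {t : ℝ} (ht : 0 ≤ t) : F (β t) ≤ F β₀ := by
  have hmem (s : ℝ) (hs : 0 ≤ s) : β s ∈ B := h.mem hB.isClosed hs
  obtain ⟨v, hv⟩ := h.exists_isFlowVelocity hB.isClosed
  obtain ⟨C, hC⟩ :=
    hB.exists_bound_of_continuousOn (continuous_gradient_of_contDiff hF).continuousOn
  have hβ : LipschitzOnWith C.toNNReal β (Ici 0) :=
    hv.lipschitzOnWith fun s hs => (hC _ (hmem s hs)).trans (Real.le_coe_toNNReal C)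
  obtain ⟨K, hK⟩ := hF.contDiffOn.exists_lipschitzOnWith one_ne_zero hBc hB
  have hFβ : LipschitzOnWith (K * C.toNNReal) (F ∘ β) (uIcc 0 t) :=
    (hK.comp hβ hmem).mono (uIcc_of_le ht ▸ Icc_subset_Ici_self)
  have hFTC := hFβ.absolutelyContinuousOnInterval.integral_deriv_eq_sub
  have hnonpos : ∫ s in (0 : ℝ)..t, deriv (F ∘ β) s ≤ 0 := by
    rw [intervalIntegral.integral_of_le ht]
    refine integral_nonpos_of_ae ((ae_restrict_iff' measurableSet_Ioc).2 ?_)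
    filter_upwards [hv.deriv_comp_nonpos (hF.differentiable one_ne_zero)] with s hs hs0
      using hs hs0.1
  simp only [Function.comp_apply, h.zero] at hFTC
  linarith

section Decay

variable {x w : ℝ → ℝ} {c M t : ℝ}

lemma le_sub_mul_of_decay (hw : ∀ t, 0 ≤ t → IntervalIntegrable w volume 0 t)
    (hxw : ∀ t, 0 ≤ t → x t = x 0 + ∫ s in (0 : ℝ)..t, w s)
    (hdec : ∀ᵐ t, 0 < t → 0 < x t → w t ≤ -c) {s : ℝ} (hs : 0 ≤ s) (hst : s ≤ t)
    (hpos : ∀ r ∈ Ioc s t, 0 < x r) : x t ≤ x s - c * (t - s) := by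
  have ht : 0 ≤ t := hs.trans hst
  have hint : IntervalIntegrable w volume s t := (hw s hs).symm.trans (hw t ht)
  have hadd : x t = x s + ∫ r in s..t, w r := by
    rw [hxw t ht, hxw s hs, add_assoc,
      intervalIntegral.integral_add_adjacent_intervals (hw s hs) hint]
  have hle : ∫ r in s..t, w r ≤ ∫ _ in s..t, -c := by
    rw [intervalIntegral.integral_of_le hst, intervalIntegral.integral_of_le hst]
    refine setIntegral_mono_ae_restrict hint.1 (by simp) ((ae_restrict_iff' measurableSet_Ioc).2 ?_)
    filter_upwards [hdec] with r hr hrst using hr (hs.trans_lt hrst.1) (hpos r hrst)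
  rw [intervalIntegral.integral_const, smul_eq_mul] at hle
  linarith

lemma eq_zero_of_decay (hc : 0 < c) (hx0 : ∀ t, 0 ≤ t → 0 ≤ x t) (hxM : x 0 ≤ M)
    (hw : ∀ t, 0 ≤ t → IntervalIntegrable w volume 0 t)
    (hxw : ∀ t, 0 ≤ t → x t = x 0 + ∫ s in (0 : ℝ)..t, w s)
    (hdec : ∀ᵐ t, 0 < t → 0 < x t → w t ≤ -c) (ht : 0 ≤ t) (htM : M / c < t) : x t = 0 := by
  by_contra hne
  have hpos : 0 < x t := (hx0 t ht).lt_of_ne' hne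
  have hcont : ContinuousOn x (Icc 0 t) :=
    ((continuousOn_primitive_Ici hw (x 0)).congr hxw).mono Icc_subset_Ici_self
  by_cases hzero : ∃ r ∈ Icc 0 t, x r ≤ 0
  · have hcompact : IsCompact {r ∈ Icc 0 t | x r ≤ 0} :=
      isCompact_Icc.of_isClosed_subset
        (hcont.preimage_isClosed_of_isClosed isClosed_Icc isClosed_Iic) inter_subset_left
    obtain ⟨s, ⟨hs, hxs⟩, hlast⟩ := hcompact.exists_isGreatest hzero
    have hdecay := le_sub_mul_of_decay hw hxw hdec hs.1 hs.2 fun r hr => by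
      by_contra! hxr
      exact (hlast ⟨⟨hs.1.trans hr.1.le, hr.2⟩, hxr⟩).not_gt hr.1
    have : 0 ≤ c * (t - s) := mul_nonneg hc.le (sub_nonneg.2 hs.2)
    linarith
  · push Not at hzero
    have hdecay := le_sub_mul_of_decay hw hxw hdec le_rfl ht fun r hr => hzero r ⟨hr.1.le, hr.2⟩
    rw [div_lt_iff₀ hc] at htM
    linarith

end Decay

lemma nonneg_of_mem_normalCone_feasibleSet {M : ℝ} {x g : EuclideanSpace ℝ (Fin p)}
    (hg : g ∈ normalCone (feasibleSet p M) x) {l : Fin p} (hl : 0 < x l) : 0 ≤ g l := by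
  have hproj : x - EuclideanSpace.single l (x l) ∈ feasibleSet p M := by
    intro i
    by_cases hi : i = l
    · subst hi
      simpa using (hg.1 i).1.trans (hg.1 i).2
    · simpa [hi] using hg.1 i
  have hinner := hg.2 _ hproj
  rw [sub_sub_cancel_left, inner_neg_right, EuclideanSpace.inner_single_right, conj_trivial,
    neg_nonpos] at hinner
  exact nonneg_of_mul_nonneg_right hinner hl

lemma IsGradientFlow.coord_eq_zero {M c : ℝ} (h : IsGradientFlow F (feasibleSet p M) β₀ β)
    (hF : ContDiff ℝ 1 F) (l : Fin p) (hc : 0 < c)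
    (hgrad : ∀ x ∈ feasibleSet p M, F x ≤ F β₀ → c ≤ gradient F x l)
    {t : ℝ} (ht : 0 ≤ t) (htM : M / c < t) : β t l = 0 := by
  have hB := isCompact_feasibleSet p M
  have hmem (s : ℝ) (hs : 0 ≤ s) := h.mem hB.isClosed hs
  obtain ⟨v, hv⟩ := h.exists_isFlowVelocity hB.isClosed
  let coord : EuclideanSpace ℝ (Fin p) →L[ℝ] ℝ := EuclideanSpace.proj l
  refine eq_zero_of_decay (x := coord ∘ β) (w := coord ∘ v) hc
    (fun s hs => (hmem s hs l).1) (hmem 0 le_rfl l).2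
    (fun s hs => ⟨coord.integrable_comp (hv.intervalIntegrable s hs).1,
      coord.integrable_comp (hv.intervalIntegrable s hs).2⟩) (fun s hs => ?_) ?_ ht htM
  · have hint := coord.intervalIntegral_comp_comm (hv.intervalIntegrable s hs)
    simp only [Function.comp_apply, hint, ← map_add, ← hv.eq_integral s hs]
  · filter_upwards [hv.exists_normal] with s hs hs0 hpos
    obtain ⟨g, hg, hvg, -⟩ := hs hs0
    have hgl := nonneg_of_mem_normalCone_feasibleSet hg hpos
    have hgradl := hgrad _ (hmem s hs0.le) (h.objective_le hB (convex_feasibleSet p M) hF hs0.le)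
    change v s l ≤ -c
    rw [hvg, PiLp.sub_apply, PiLp.neg_apply]
    linarith

end Flow

/-! ### Uniform concentration of empirical means -/

section Concentration

variable {Z : Type*} [MeasurableSpace Z] {Q : Measure Z}

/-- The event `E n`, on samples of size `n` drawn independently from `Q`, fails with probability
at most `exp (-c n)` for some `c > 0` and all large `n`. The failure probability is an outer
measure, so that no measurability has to be carried along. -/
def WithExpHighProbability (Q : Measure Z) (E : ∀ n : ℕ, (Fin n → Z) → Prop) : Prop :=
  ∃ c : ℝ, 0 < c ∧ ∀ᶠ n : ℕ in atTop,
    Measure.pi (fun _ : Fin n => Q) {z | ¬E n z} ≤ ENNReal.ofReal (Real.exp (-(c * n)))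

namespace WithExpHighProbability

variable {E E' : ∀ n : ℕ, (Fin n → Z) → Prop}

lemma mono (h : WithExpHighProbability Q E) (hE : ∀ᶠ n in atTop, ∀ z, E n z → E' n z) :
    WithExpHighProbability Q E' := by
  obtain ⟨c, hc, hbad⟩ := h
  refine ⟨c, hc, ?_⟩
  filter_upwards [hbad, hE] with n hn hEn
  exact (measure_mono fun z => mt (hEn z)).trans hn

lemma of_le_const_mul {k c : ℝ} (hc : 0 < c) (h : ∀ᶠ n : ℕ in atTop,
      Measure.pi (fun _ : Fin n => Q) {z | ¬E n z} ≤ ENNReal.ofReal (k * Real.exp (-(c * n)))) :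
    WithExpHighProbability Q E := by
  have hlim : Tendsto (fun n : ℕ => k * Real.exp (-(c / 2 * n))) atTop (𝓝 (k * 0)) :=
    (Real.tendsto_exp_neg_atTop_nhds_zero.comp
      (tendsto_natCast_atTop_atTop.const_mul_atTop (half_pos hc))).const_mul k
  rw [mul_zero] at hlim
  refine ⟨c / 2, half_pos hc, ?_⟩
  filter_upwards [h, hlim.eventually_le_const one_pos] with n hn hk
  refine hn.trans (ENNReal.ofReal_le_ofReal ?_)
  calc k * Real.exp (-(c * n))
      = k * Real.exp (-(c / 2 * n)) * Real.exp (-(c / 2 * n)) := by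
        rw [mul_assoc, ← Real.exp_add]
        ring_nf
    _ ≤ 1 * Real.exp (-(c / 2 * n)) := by gcongr
    _ = Real.exp (-(c / 2 * n)) := one_mul _

lemma forall_of_finite {ι : Type*} [Finite ι] {E : ι → ∀ n : ℕ, (Fin n → Z) → Prop}
    (h : ∀ i, WithExpHighProbability Q (E i)) :
    WithExpHighProbability Q fun n z => ∀ i, E i n z := by
  have := Fintype.ofFinite ι
  choose c hc hbad using h
  have hmin : ∀ᶠ d in 𝓝[>] (0 : ℝ), ∀ i, d ≤ c i :=
    eventually_all.2 fun i => nhdsWithin_le_nhds (Iic_mem_nhds (hc i))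
  obtain ⟨d, hdc, hd⟩ := (hmin.and self_mem_nhdsWithin).exists
  refine of_le_const_mul (k := Fintype.card ι) (c := d) hd ?_
  filter_upwards [eventually_all.2 hbad] with n hn
  calc Measure.pi (fun _ : Fin n => Q) {z | ¬∀ i, E i n z}
      = Measure.pi (fun _ : Fin n => Q) (⋃ i, {z | ¬E i n z}) := by
        congr 1
        ext z
        simp
    _ ≤ ∑ i, Measure.pi (fun _ : Fin n => Q) {z | ¬E i n z} := measure_iUnion_fintype_le _ _
    _ ≤ ∑ _i : ι, ENNReal.ofReal (Real.exp (-(d * n))) := by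
        gcongr with i
        refine (hn i).trans (ENNReal.ofReal_le_ofReal ?_)
        gcongr
        exact hdc i
    _ = ENNReal.ofReal (Fintype.card ι * Real.exp (-(d * n))) := by
        rw [Finset.sum_const, Finset.card_univ, ← nsmul_eq_mul, ENNReal.ofReal_nsmul]

lemma and (h : WithExpHighProbability Q E) (h' : WithExpHighProbability Q E') :
    WithExpHighProbability Q fun n z => E n z ∧ E' n z :=
  (forall_of_finite (ι := Bool) (E := fun b => cond b E E') (Bool.rec h' h)).mono <|
    .of_forall fun _ _ hz => ⟨hz true, hz false⟩

lemma of_ae [IsProbabilityMeasure Q] {good : Z → Prop} (h : ∀ᵐ z ∂Q, good z) :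
    WithExpHighProbability Q fun _ z => ∀ j, good (z j) := by
  refine ⟨1, one_pos, .of_forall fun n => ?_⟩
  have hall : ∀ᵐ z ∂Measure.pi (fun _ : Fin n => Q), ∀ j, good (z j) := ae_all_iff.2 fun j =>
    (measurePreserving_eval (fun _ : Fin n => Q) j).quasiMeasurePreserving.ae h
  rw [ae_iff.1 hall]
  exact zero_le

lemma exists_measurableSet [IsProbabilityMeasure Q] (h : WithExpHighProbability Q E) :
    ∃ c : ℝ, 0 < c ∧ ∃ n₀ : ℕ, ∀ n, n₀ ≤ n → ∃ A : Set (Fin n → Z), MeasurableSet A ∧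
      ENNReal.ofReal (1 - Real.exp (-(c * n))) ≤ Measure.pi (fun _ => Q) A ∧ ∀ z ∈ A, E n z := by
  obtain ⟨c, hc, hbad⟩ := h
  obtain ⟨n₀, hn₀⟩ := eventually_atTop.1 hbad
  refine ⟨c, hc, n₀, fun n hn => ?_⟩
  set P := Measure.pi fun _ : Fin n => Q
  refine ⟨(toMeasurable P {z | ¬E n z})ᶜ, (measurableSet_toMeasurable _ _).compl, ?_, ?_⟩
  · rw [prob_compl_eq_one_sub (measurableSet_toMeasurable _ _), measure_toMeasurable,
      ENNReal.ofReal_sub _ (Real.exp_nonneg _), ENNReal.ofReal_one]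
    exact tsub_le_tsub_left (hn₀ n hn) 1
  · intro z hz
    by_contra hE
    exact hz (subset_toMeasurable _ _ hE)

end WithExpHighProbability

variable [IsProbabilityMeasure Q]

lemma measureReal_mean_sub_integral_ge {f : Z → ℝ} (hf : AEMeasurable f Q) {b ε : ℝ}
    (hfb : ∀ᵐ z ∂Q, |f z| ≤ b) (hε : 0 ≤ ε) {n : ℕ} (hn : 0 < n) :
    (Measure.pi fun _ : Fin n => Q).real {z | ε ≤ (n : ℝ)⁻¹ * ∑ j, f (z j) - ∫ z, f z ∂Q}
      ≤ Real.exp (-(n * ε ^ 2 / (2 * b ^ 2))) := by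
  have hn' : (0 : ℝ) < n := by exact_mod_cast hn
  have hsub : HasSubgaussianMGF (fun z => f z - ∫ z, f z ∂Q) ((‖b - -b‖₊ / 2) ^ 2) Q :=
    hasSubgaussianMGF_of_mem_Icc hf (by filter_upwards [hfb] with z hz using abs_le.1 hz)
  have hsub_eval (j : Fin n) : HasSubgaussianMGF (fun z : Fin n → Z => f (z j) - ∫ z, f z ∂Q)
      ((‖b - -b‖₊ / 2) ^ 2) (Measure.pi fun _ => Q) := by
    have heval := measurePreserving_eval (fun _ : Fin n => Q) j
    refine HasSubgaussianMGF.of_map (X := fun z => f z - ∫ z, f z ∂Q)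
      (Y := fun z : Fin n → Z => z j)
      heval.measurable.aemeasurable ?_
    rwa [heval.map_eq]
  have hindep : iIndepFun (fun (j : Fin n) (z : Fin n → Z) => f (z j) - ∫ z, f z ∂Q)
      (Measure.pi fun _ => Q) :=
    iIndepFun_pi (X := fun _ z => f z - ∫ z, f z ∂Q) fun _ => hf.sub_const _
  have hoeffding := HasSubgaussianMGF.measure_sum_ge_le_of_iIndepFun hindep (s := Finset.univ)
    (ε := n * ε) (fun j _ => hsub_eval j) (by positivity)
  refine le_of_eq_of_le ?_ (hoeffding.trans_eq ?_)
  · congr 1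
    ext z
    simp only [mem_ofPred_eq, Finset.sum_sub_distrib, Finset.sum_const, Finset.card_univ,
      Fintype.card_fin, nsmul_eq_mul]
    rw [← mul_le_mul_iff_right₀ hn', mul_sub, mul_inv_cancel_left₀ hn'.ne']
  · have hb : ((‖b - -b‖₊ / 2 : NNReal) : ℝ) ^ 2 = b ^ 2 := by
      simp only [NNReal.coe_div, coe_nnnorm, Real.norm_eq_abs, NNReal.coe_ofNat, sub_neg_eq_add,
        div_pow, sq_abs]
      ring
    simp only [Finset.sum_const, Finset.card_univ, Fintype.card_fin, nsmul_eq_mul, NNReal.coe_mul,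
      NNReal.coe_natCast, NNReal.coe_pow, hb]
    congr 1
    field_simp

lemma withExpHighProbability_mean_sub_integral_le {f : Z → ℝ} (hf : AEMeasurable f Q) {b ε : ℝ}
    (hfb : ∀ᵐ z ∂Q, |f z| ≤ b) (hε : 0 < ε) :
    WithExpHighProbability Q fun n z => (n : ℝ)⁻¹ * ∑ j, f (z j) - ∫ z, f z ∂Q ≤ ε := by
  have hfb' : ∀ᵐ z ∂Q, |f z| ≤ |b| + 1 := hfb.mono fun z hz => by linarith [le_abs_self b]
  refine ⟨ε ^ 2 / (2 * (|b| + 1) ^ 2), by positivity, ?_⟩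
  filter_upwards [eventually_gt_atTop 0] with n hn
  rw [← ofReal_measureReal]
  refine ENNReal.ofReal_le_ofReal ?_
  calc (Measure.pi fun _ : Fin n => Q).real
        {z | ¬(n : ℝ)⁻¹ * ∑ j, f (z j) - ∫ z, f z ∂Q ≤ ε}
      ≤ (Measure.pi fun _ : Fin n => Q).real
        {z | ε ≤ (n : ℝ)⁻¹ * ∑ j, f (z j) - ∫ z, f z ∂Q} :=
        measureReal_mono fun z hz => (not_le.1 hz).le
    _ ≤ Real.exp (-(n * ε ^ 2 / (2 * (|b| + 1) ^ 2))) :=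
        measureReal_mean_sub_integral_ge hf hfb' hε.le hn
    _ = Real.exp (-(ε ^ 2 / (2 * (|b| + 1) ^ 2) * n)) := by ring_nf

lemma withExpHighProbability_abs_mean_sub_integral_le {f : Z → ℝ} (hf : AEMeasurable f Q) {b ε : ℝ}
    (hfb : ∀ᵐ z ∂Q, |f z| ≤ b) (hε : 0 < ε) :
    WithExpHighProbability Q fun n z => |(n : ℝ)⁻¹ * ∑ j, f (z j) - ∫ z, f z ∂Q| ≤ ε := by
  have hneg := withExpHighProbability_mean_sub_integral_le (f := fun z => -f z) hf.neg
    (by simpa using hfb) hε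
  refine ((withExpHighProbability_mean_sub_integral_le hf hfb hε).and hneg).mono <|
    .of_forall fun n z hz => abs_le.2 ⟨?_, hz.1⟩
  simp only [Finset.sum_neg_distrib, integral_neg] at hz
  linarith [hz.2]

lemma abs_mean_sub_mean_le {ι : Type*} [Fintype ι] {x y : ι → ℝ} {ε : ℝ} (hε : 0 ≤ ε)
    (h : ∀ i, |x i - y i| ≤ ε) :
    |(Fintype.card ι : ℝ)⁻¹ * ∑ i, x i - (Fintype.card ι : ℝ)⁻¹ * ∑ i, y i| ≤ ε := by
  rw [← mul_sub, ← Finset.sum_sub_distrib, abs_mul, abs_of_nonneg (by positivity)]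
  calc (Fintype.card ι : ℝ)⁻¹ * |∑ i, (x i - y i)|
      ≤ (Fintype.card ι : ℝ)⁻¹ * ∑ _i : ι, ε := by
        gcongr
        exact (Finset.abs_sum_le_sum_abs _ _).trans (Finset.sum_le_sum fun i _ => h i)
    _ = (Fintype.card ι : ℝ)⁻¹ * Fintype.card ι * ε := by
        rw [Finset.sum_const, Finset.card_univ, nsmul_eq_mul, mul_assoc]
    _ ≤ 1 * ε := by
        gcongr
        exact inv_mul_le_one
    _ = ε := one_mul ε

lemma exists_finite_uniform_net {T X : Type*} [PseudoMetricSpace T] [PseudoMetricSpace X]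
    {Θ : Set T} {K : Set X} (hΘ : IsCompact Θ) (hK : IsCompact K) {g : T → X → ℝ}
    (hg : Continuous (Function.uncurry g)) {ε : ℝ} (hε : 0 < ε) :
    ∃ N ⊆ Θ, N.Finite ∧ ∀ θ ∈ Θ, ∃ θ' ∈ N, ∀ x ∈ K, |g θ x - g θ' x| ≤ ε := by
  obtain ⟨δ, hδ, hclose⟩ := Metric.uniformContinuousOn_iff.1
    ((hΘ.prod hK).uniformContinuousOn_of_continuous hg.continuousOn) ε hε
  obtain ⟨N, hNΘ, hN, hcover⟩ := hΘ.finite_cover_balls hδ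
  refine ⟨N, hNΘ, hN, fun θ hθ => ?_⟩
  obtain ⟨θ', hθ', hdist⟩ := mem_iUnion₂.1 (hcover hθ)
  have hdist' (x : X) : dist (θ, x) (θ', x) < δ := by simpa [Prod.dist_eq, hδ] using hdist
  exact ⟨θ', hθ', fun x hx => (hclose (θ, x) ⟨hθ, hx⟩ (θ', x) ⟨hNΘ hθ', hx⟩ (hdist' x)).le⟩

lemma withExpHighProbability_forall_abs_mean_sub_integral_le [PseudoMetricSpace Z]
    [OpensMeasurableSpace Z] {T : Type*} [PseudoMetricSpace T] {K : Set Z} (hK : IsCompact K)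
    (hQK : ∀ᵐ z ∂Q, z ∈ K) {Θ : Set T} (hΘ : IsCompact Θ) {g : T → Z → ℝ}
    (hg : Continuous (Function.uncurry g)) {ε : ℝ} (hε : 0 < ε) :
    WithExpHighProbability Q fun n z =>
      ∀ θ ∈ Θ, |(n : ℝ)⁻¹ * ∑ j, g θ (z j) - ∫ z, g θ z ∂Q| ≤ ε := by
  have hcont (θ : T) : Continuous (g θ) := hg.comp (Continuous.prodMk_right θ)
  have hbound (θ : T) : ∃ b, ∀ᵐ z ∂Q, |g θ z| ≤ b := by
    obtain ⟨b, hb⟩ := hK.exists_bound_of_continuousOn (hcont θ).continuousOn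
    exact ⟨b, hQK.mono hb⟩
  choose b hb using hbound
  have hint (θ : T) : Integrable (g θ) Q :=
    Integrable.of_bound (hcont θ).aestronglyMeasurable (b θ) (hb θ)
  obtain ⟨N, -, hN, hnet⟩ := exists_finite_uniform_net hΘ hK hg (ε := ε / 3) (by positivity)
  have := hN.fintype
  have hNet : WithExpHighProbability Q fun n z =>
      ∀ θ : N, |(n : ℝ)⁻¹ * ∑ j, g θ (z j) - ∫ z, g θ z ∂Q| ≤ ε / 3 :=
    .forall_of_finite fun θ => withExpHighProbability_abs_mean_sub_integral_le
      (hcont θ).aemeasurable (hb θ) (by positivity)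
  refine (hNet.and (.of_ae hQK)).mono <| .of_forall fun n z ⟨hz, hzK⟩ θ hθ => ?_
  obtain ⟨θ', hθ', hclose⟩ := hnet θ hθ
  have hmean := abs_mean_sub_mean_le (by positivity) fun j => hclose (z j) (hzK j)
  have hintegral : |∫ z, g θ z ∂Q - ∫ z, g θ' z ∂Q| ≤ ε / 3 := by
    rw [← integral_sub (hint θ) (hint θ')]
    simpa using norm_integral_le_of_norm_le_const (f := fun z => g θ z - g θ' z)
      (hQK.mono hclose)
  have hN := hz ⟨θ', hθ'⟩
  rw [Fintype.card_fin] at hmean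
  rw [abs_le] at hmean hintegral hN ⊢
  constructor <;> linarith

end Concentration

/-! ### The objective and its gradient -/

section CompactSupport

variable {X Y : Type*} [MeasurableSpace X] [TopologicalSpace X] [MeasurableSpace Y]

lemma integrable_of_continuous_of_ae_mem_isCompact [OpensMeasurableSpace X]
    {P : Measure X} [IsFiniteMeasure P] {K : Set X} (hK : IsCompact K)
    (hPK : ∀ᵐ x ∂P, x ∈ K) {f : X → ℝ} (hf : Continuous f) : Integrable f P := by
  obtain ⟨C, hC⟩ := hK.exists_bound_of_continuousOn hf.continuousOn
  exact Integrable.of_bound hf.aestronglyMeasurable C (hPK.mono hC)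

omit [TopologicalSpace X] in
lemma ae_prod_mem_prod {P : Measure X} {ν : Measure Y} [SFinite P] [SFinite ν] {K : Set X}
    {L : Set Y} (hK : ∀ᵐ x ∂P, x ∈ K) (hL : ∀ᵐ y ∂ν, y ∈ L) :
    ∀ᵐ w ∂P.prod ν, w ∈ K ×ˢ L :=
  (Measure.quasiMeasurePreserving_fst.ae hK).and (Measure.quasiMeasurePreserving_snd.ae hL)

end CompactSupport

section Kernel

variable {μ : Measure ℝ}

lemma KernelMeasure.exists_bounds (hμ : KernelMeasure μ) :
    ∃ a b : ℝ, 0 < a ∧ a ≤ b ∧ ∀ᵐ t ∂μ, t ∈ Icc a b := by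
  obtain ⟨a, b, ha, hab⟩ := hμ.support_subset
  have hae : ∀ᵐ t ∂μ, t ∈ Icc a b := by
    filter_upwards [Measure.support_mem_ae] with t ht using hab ht
  have : (ae μ).NeBot := ae_neBot.2 hμ.ne_zero
  obtain ⟨t, ht⟩ := hae.exists
  exact ⟨a, b, ha, ht.1.trans ht.2, hae⟩

/-- The function `-h'`, that is `z ↦ ∫ t exp (-t z) μ(dt)`. -/
def kernelSlope (μ : Measure ℝ) (z : ℝ) : ℝ := ∫ t, t * Real.exp (-(t * z)) ∂μ

lemma KernelMeasure.integrable_of_continuous (hμ : KernelMeasure μ) {f : ℝ → ℝ}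
    (hf : Continuous f) : Integrable f μ := by
  have := hμ.finite
  obtain ⟨a, b, -, -, hae⟩ := hμ.exists_bounds
  exact integrable_of_continuous_of_ae_mem_isCompact isCompact_Icc hae hf

lemma KernelMeasure.integrableExpSet_eq (hμ : KernelMeasure μ) :
    integrableExpSet id μ = Set.univ := by
  ext z
  simpa [integrableExpSet] using hμ.integrable_of_continuous (by fun_prop)

lemma kernelFun_eq_mgf (μ : Measure ℝ) : kernelFun μ = fun z => mgf id μ (-z) := by
  ext z
  simp only [kernelFun, mgf, id, neg_mul, mul_comm z]

lemma KernelMeasure.kernelSlope_eq_deriv_mgf (hμ : KernelMeasure μ) :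
    kernelSlope μ = fun z => deriv (mgf id μ) (-z) := by
  ext z
  rw [deriv_mgf (by simp [hμ.integrableExpSet_eq])]
  simp only [kernelSlope, id, neg_mul, mul_comm z]

lemma KernelMeasure.analyticOnNhd_mgf (hμ : KernelMeasure μ) :
    AnalyticOnNhd ℝ (mgf id μ) Set.univ := by
  simpa [hμ.integrableExpSet_eq] using ProbabilityTheory.analyticOnNhd_mgf (X := id) (μ := μ)

lemma KernelMeasure.contDiff_kernelFun (hμ : KernelMeasure μ) : ContDiff ℝ 1 (kernelFun μ) := by
  rw [kernelFun_eq_mgf]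
  exact (contDiffOn_univ.1 (hμ.analyticOnNhd_mgf.contDiffOn uniqueDiffOn_univ)).comp contDiff_neg

lemma KernelMeasure.hasDerivAt_kernelFun (hμ : KernelMeasure μ) (z : ℝ) :
    HasDerivAt (kernelFun μ) (-kernelSlope μ z) z := by
  rw [hμ.kernelSlope_eq_deriv_mgf, kernelFun_eq_mgf]
  simpa [Function.comp_def] using
    (hμ.analyticOnNhd_mgf (-z) trivial).differentiableAt.hasDerivAt.scomp z (hasDerivAt_neg z)

lemma KernelMeasure.continuous_kernelSlope (hμ : KernelMeasure μ) :
    Continuous (kernelSlope μ) := by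
  rw [hμ.kernelSlope_eq_deriv_mgf]
  exact (continuousOn_univ.1 hμ.analyticOnNhd_mgf.deriv.continuousOn).comp continuous_neg

end Kernel

section Objective

/-- The integrand of `-objective`. -/
def valueKernel (q : ℕ) (μ : Measure ℝ) (β : EuclideanSpace ℝ (Fin p)) (w w' : Obs p) : ℝ :=
  w.2 * w'.2 * kernelFun μ (weightedNormPow q β (fun i => w.1 i - w'.1 i))

/-- The integrand of the partial derivative of `objective` in the direction `l`. -/
def slopeKernel (q : ℕ) (μ : Measure ℝ) (l : Fin p) (β : EuclideanSpace ℝ (Fin p))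
    (w w' : Obs p) : ℝ :=
  w.2 * w'.2 * (|w.1 l - w'.1 l| ^ q *
    kernelSlope μ (weightedNormPow q β (fun i => w.1 i - w'.1 i)))

/-- The partial derivative of `objective` in the direction `l`. -/
def objectiveSlope (q : ℕ) (μ : Measure ℝ) (Q : Measure (Obs p)) (l : Fin p)
    (β : EuclideanSpace ℝ (Fin p)) : ℝ :=
  ∫ w, slopeKernel q μ l β w.1 w.2 ∂(Q.prod Q)

lemma objective_eq_neg_integral_valueKernel (q : ℕ) (μ : Measure ℝ) (Q : Measure (Obs p))
    (β : EuclideanSpace ℝ (Fin p)) :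
    objective q μ Q β = -∫ w, valueKernel q μ β w.1 w.2 ∂(Q.prod Q) := rfl

lemma weightedNormPow_zero (q : ℕ) (x : Fin p → ℝ) : weightedNormPow q 0 x = 0 := by
  simp [weightedNormPow]

lemma objective_zero (q : ℕ) (μ : Measure ℝ) {Q : Measure (Obs p)} [SFinite Q]
    (hc : ∫ z, z.2 ∂Q = 0) : objective q μ Q 0 = 0 := by
  simp only [objective, weightedNormPow_zero]
  rw [integral_mul_const, integral_prod_mul (fun z : Obs p => z.2) (fun z : Obs p => z.2), hc]
  simp

lemma weightedNormPow_sub_comm (q : ℕ) (β : EuclideanSpace ℝ (Fin p)) (x x' : Fin p → ℝ) :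
    weightedNormPow q β (fun i => x i - x' i) = weightedNormPow q β (fun i => x' i - x i) := by
  simp only [weightedNormPow, abs_sub_comm]

variable {μ : Measure ℝ}

lemma continuous_weightedNormPow_sub (q : ℕ) :
    Continuous fun x : EuclideanSpace ℝ (Fin p) × Obs p × Obs p =>
      weightedNormPow q x.1 (fun i => x.2.1.1 i - x.2.2.1 i) := by
  unfold weightedNormPow
  fun_prop

lemma continuous_valueKernel (hμ : KernelMeasure μ) (q : ℕ) :
    Continuous fun x : EuclideanSpace ℝ (Fin p) × Obs p × Obs p =>
      valueKernel q μ x.1 x.2.1 x.2.2 :=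
  Continuous.mul (by fun_prop)
    (hμ.contDiff_kernelFun.continuous.comp (continuous_weightedNormPow_sub q))

lemma continuous_slopeKernel (hμ : KernelMeasure μ) (q : ℕ) (l : Fin p) :
    Continuous fun x : EuclideanSpace ℝ (Fin p) × Obs p × Obs p =>
      slopeKernel q μ l x.1 x.2.1 x.2.2 :=
  Continuous.mul (by fun_prop)
    (Continuous.mul (by fun_prop)
      (hμ.continuous_kernelSlope.comp (continuous_weightedNormPow_sub q)))

lemma valueKernel_comm (q : ℕ) (β : EuclideanSpace ℝ (Fin p)) (w w' : Obs p) :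
    valueKernel q μ β w w' = valueKernel q μ β w' w := by
  simp only [valueKernel, weightedNormPow_sub_comm q β w.1, mul_comm w.2]

lemma slopeKernel_comm (q : ℕ) (l : Fin p) (β : EuclideanSpace ℝ (Fin p)) (w w' : Obs p) :
    slopeKernel q μ l β w w' = slopeKernel q μ l β w' w := by
  simp only [slopeKernel, weightedNormPow_sub_comm q β w.1, mul_comm w.2, abs_sub_comm (w.1 l)]

/-- The linear form `β ↦ ∑ i, β i * |x i| ^ q`, the derivative of `weightedNormPow` in the
weights. -/
def weightedNormPowCLM (q : ℕ) (x : Fin p → ℝ) : EuclideanSpace ℝ (Fin p) →L[ℝ] ℝ :=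
  ∑ i, |x i| ^ q • EuclideanSpace.proj i

lemma weightedNormPowCLM_apply (q : ℕ) (x : Fin p → ℝ) (β : EuclideanSpace ℝ (Fin p)) :
    weightedNormPowCLM q x β = weightedNormPow q β x := by
  simp [weightedNormPowCLM, weightedNormPow, mul_comm]

lemma weightedNormPow_single (q : ℕ) (x : Fin p → ℝ) (l : Fin p) :
    weightedNormPow q (EuclideanSpace.single l 1) x = |x l| ^ q := by
  simp [weightedNormPow]

lemma valueKernel_eq_comp (q : ℕ) (w w' : Obs p) :
    (fun β => valueKernel q μ β w w') = fun β => w.2 * w'.2 *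
      (kernelFun μ ∘ weightedNormPowCLM q fun i => w.1 i - w'.1 i) β := by
  simp only [valueKernel, Function.comp_apply, weightedNormPowCLM_apply]

lemma contDiff_valueKernel (hμ : KernelMeasure μ) (q : ℕ) (w w' : Obs p) :
    ContDiff ℝ 1 fun β => valueKernel q μ β w w' := by
  rw [valueKernel_eq_comp]
  exact contDiff_const.mul (hμ.contDiff_kernelFun.comp (ContinuousLinearMap.contDiff _))

lemma fderiv_valueKernel_single (hμ : KernelMeasure μ) (q : ℕ) (w w' : Obs p)
    (β : EuclideanSpace ℝ (Fin p)) (l : Fin p) :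
    fderiv ℝ (fun β => valueKernel q μ β w w') β (EuclideanSpace.single l 1) =
      -slopeKernel q μ l β w w' := by
  rw [valueKernel_eq_comp, (((hμ.hasDerivAt_kernelFun _).comp_hasFDerivAt β
    (ContinuousLinearMap.hasFDerivAt _)).const_mul _).fderiv]
  simp only [smul_apply, smul_eq_mul, weightedNormPowCLM_apply, weightedNormPow_single,
    slopeKernel]
  ring

lemma gradient_apply (f : EuclideanSpace ℝ (Fin p) → ℝ) (x : EuclideanSpace ℝ (Fin p))
    (l : Fin p) : gradient f x l = fderiv ℝ f x (EuclideanSpace.single l 1) := by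
  have hinner : inner ℝ (gradient f x) (EuclideanSpace.single l (1 : ℝ)) =
      fderiv ℝ f x (EuclideanSpace.single l 1) := InnerProductSpace.toDual_symm_apply
  rw [← hinner, EuclideanSpace.inner_single_right]
  simp

end Objective

section Empirical

variable {n : ℕ} (z : Fin n → Obs p)

lemma isProbabilityMeasure_empiricalMeasure (hn : n ≠ 0) :
    IsProbabilityMeasure (empiricalMeasure z) := by
  constructor
  simp only [empiricalMeasure, Measure.smul_apply, Measure.coe_finsetSum, Finset.sum_apply,
    measure_univ, Finset.sum_const, Finset.card_univ, Fintype.card_fin, nsmul_eq_mul, mul_one,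
    smul_eq_mul]
  exact ENNReal.inv_mul_cancel (by exact_mod_cast hn) (by simp)

lemma integral_empiricalMeasure (f : Obs p → ℝ) :
    ∫ x, f x ∂(empiricalMeasure z) = (n : ℝ)⁻¹ * ∑ j, f (z j) := by
  rw [empiricalMeasure, integral_smul_measure, integral_finsetSum_measure
    (fun j _ => integrable_dirac (by simp))]
  simp

lemma ae_empiricalMeasure_mem_range : ∀ᵐ x ∂(empiricalMeasure z), x ∈ range z := by
  refine Measure.ae_smul_measure ?_ _
  rw [ae_iff, Measure.finsetSum_apply]
  refine Finset.sum_eq_zero fun j _ => ?_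
  rw [← ae_iff, ae_dirac_eq]
  exact mem_range_self j

lemma integral_empiricalMeasure_prod (hn : n ≠ 0) {f : Obs p × Obs p → ℝ} (hf : Continuous f) :
    ∫ w, f w ∂((empiricalMeasure z).prod (empiricalMeasure z)) =
      (n : ℝ)⁻¹ * ∑ i, (n : ℝ)⁻¹ * ∑ j, f (z i, z j) := by
  have := isProbabilityMeasure_empiricalMeasure z hn
  have hrange := ae_empiricalMeasure_mem_range z
  have hcompact := (finite_range z).isCompact
  rw [integral_prod f (integrable_of_continuous_of_ae_mem_isCompact (hcompact.prod hcompact)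
    (ae_prod_mem_prod hrange hrange) hf)]
  simp only [integral_empiricalMeasure]

variable {μ : Measure ℝ}

lemma objective_empiricalMeasure (hμ : KernelMeasure μ) (hn : n ≠ 0) (q : ℕ) :
    objective q μ (empiricalMeasure z) = fun β =>
      -((n : ℝ)⁻¹ * ∑ i, (n : ℝ)⁻¹ * ∑ j, valueKernel q μ β (z i) (z j)) := by
  ext β
  rw [objective_eq_neg_integral_valueKernel, integral_empiricalMeasure_prod z hn
    (f := fun w => valueKernel q μ β w.1 w.2)
    ((continuous_valueKernel hμ q).comp (Continuous.prodMk_right β))]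

lemma contDiff_objective_empiricalMeasure (hμ : KernelMeasure μ) (hn : n ≠ 0) (q : ℕ) :
    ContDiff ℝ 1 (objective q μ (empiricalMeasure z)) := by
  rw [objective_empiricalMeasure z hμ hn q]
  exact (contDiff_const.mul (ContDiff.sum fun i _ => contDiff_const.mul
    (ContDiff.sum fun j _ => contDiff_valueKernel hμ q (z i) (z j)))).neg

lemma gradient_objective_empiricalMeasure (hμ : KernelMeasure μ) (hn : n ≠ 0) (q : ℕ)
    (β : EuclideanSpace ℝ (Fin p)) (l : Fin p) :
    gradient (objective q μ (empiricalMeasure z)) β l =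
      objectiveSlope q μ (empiricalMeasure z) l β := by
  have hvalue (i j : Fin n) : HasFDerivAt (fun β => valueKernel q μ β (z i) (z j))
      (fderiv ℝ (fun β => valueKernel q μ β (z i) (z j)) β) β :=
    (contDiff_valueKernel hμ q (z i) (z j)).differentiable one_ne_zero β |>.hasFDerivAt
  have hobjective := (HasFDerivAt.const_mul (HasFDerivAt.fun_sum (u := Finset.univ) fun i _ =>
    HasFDerivAt.const_mul (HasFDerivAt.fun_sum (u := Finset.univ) fun j _ => hvalue i j)
      (n : ℝ)⁻¹) (n : ℝ)⁻¹).fun_neg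
  rw [gradient_apply, objective_empiricalMeasure z hμ hn q, hobjective.fderiv, objectiveSlope,
    integral_empiricalMeasure_prod z hn
      (f := fun w => slopeKernel q μ l β w.1 w.2)
      ((continuous_slopeKernel hμ q l).comp (Continuous.prodMk_right β))]
  simp only [neg_apply, smul_apply, sum_apply, fderiv_valueKernel_single hμ, smul_eq_mul,
    Finset.sum_neg_distrib, mul_neg, neg_neg]

end Empirical

section EmpiricalConcentration

variable {Q : Measure (Obs p)} [IsProbabilityMeasure Q] {K : Set (Obs p)}

lemma abs_integral_empiricalMeasure_prod_sub_le {n : ℕ} (hn : n ≠ 0) {z : Fin n → Obs p}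
    (hz : ∀ j, z j ∈ K) (hQK : ∀ᵐ x ∂Q, x ∈ K) {φ : Obs p → Obs p → ℝ}
    (hφ : Continuous fun w : Obs p × Obs p => φ w.1 w.2) (hsymm : ∀ w w', φ w w' = φ w' w)
    (hint : Integrable (fun w : Obs p × Obs p => φ w.1 w.2) (Q.prod Q))
    (hint' : ∀ x, Integrable (φ x) Q) {ε : ℝ} (hε : 0 ≤ ε)
    (hmean : ∀ x ∈ K, |(n : ℝ)⁻¹ * ∑ j, φ x (z j) - ∫ y, φ x y ∂Q| ≤ ε) :
    |∫ w, φ w.1 w.2 ∂((empiricalMeasure z).prod (empiricalMeasure z)) -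
      ∫ w, φ w.1 w.2 ∂(Q.prod Q)| ≤ 2 * ε := by
  have hint_mean : Integrable (fun y => (n : ℝ)⁻¹ * ∑ i, φ y (z i)) Q :=
    (integrable_finsetSum _ fun i _ => by simpa only [hsymm _ (z i)] using hint' (z i)).const_mul _
  have hswap : (n : ℝ)⁻¹ * ∑ i, ∫ y, φ (z i) y ∂Q = ∫ y, (n : ℝ)⁻¹ * ∑ i, φ y (z i) ∂Q := by
    rw [integral_const_mul, integral_finsetSum _ fun i _ => by
      simpa only [hsymm _ (z i)] using hint' (z i)]
    simp only [hsymm _ (z _)]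
  have hsample : |(n : ℝ)⁻¹ * ∑ i, (n : ℝ)⁻¹ * ∑ j, φ (z i) (z j) -
      (n : ℝ)⁻¹ * ∑ i, ∫ y, φ (z i) y ∂Q| ≤ ε := by
    simpa only [Fintype.card_fin] using abs_mean_sub_mean_le hε fun i => hmean (z i) (hz i)
  have hpopulation :
      |(∫ y, (n : ℝ)⁻¹ * ∑ i, φ y (z i) ∂Q) - ∫ y, ∫ y', φ y y' ∂Q ∂Q| ≤ ε := by
    rw [← integral_sub hint_mean hint.integral_prod_left]
    simpa using norm_integral_le_of_norm_le_const
      (f := fun y => (n : ℝ)⁻¹ * ∑ i, φ y (z i) - ∫ y', φ y y' ∂Q) (hQK.mono hmean)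
  rw [← hswap] at hpopulation
  rw [integral_empiricalMeasure_prod z hn hφ, integral_prod _ hint]
  rw [abs_le] at hsample hpopulation ⊢
  constructor <;> linarith

lemma withExpHighProbability_forall_abs_integral_empiricalMeasure_prod_sub_le {T : Type*}
    [PseudoMetricSpace T] {Θ : Set T} (hΘ : IsCompact Θ) (hK : IsCompact K)
    (hQK : ∀ᵐ x ∂Q, x ∈ K) {φ : T → Obs p → Obs p → ℝ}
    (hφ : Continuous fun x : T × Obs p × Obs p => φ x.1 x.2.1 x.2.2)
    (hsymm : ∀ θ w w', φ θ w w' = φ θ w' w) {ε : ℝ} (hε : 0 < ε) :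
    WithExpHighProbability Q fun _ z => ∀ θ ∈ Θ,
      |∫ w, φ θ w.1 w.2 ∂((empiricalMeasure z).prod (empiricalMeasure z)) -
        ∫ w, φ θ w.1 w.2 ∂(Q.prod Q)| ≤ ε := by
  have hsections := withExpHighProbability_forall_abs_mean_sub_integral_le hK hQK (hΘ.prod hK)
    (g := fun θ z => φ θ.1 θ.2 z)
    (hφ.comp (by fun_prop : Continuous fun x : (T × Obs p) × Obs p => (x.1.1, x.1.2, x.2)))
    (half_pos hε)
  refine (hsections.and (.of_ae hQK)).mono ?_
  filter_upwards [eventually_ne_atTop 0] with n hn z ⟨hz, hzK⟩ θ hθ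
  have hφθ : Continuous fun w : Obs p × Obs p => φ θ w.1 w.2 :=
    hφ.comp (Continuous.prodMk_right θ)
  have hmean := abs_integral_empiricalMeasure_prod_sub_le hn hzK hQK hφθ (hsymm θ)
    (integrable_of_continuous_of_ae_mem_isCompact (hK.prod hK) (ae_prod_mem_prod hQK hQK) hφθ)
    (fun x => integrable_of_continuous_of_ae_mem_isCompact hK hQK
      (hφθ.comp (Continuous.prodMk_right x)))
    (half_pos hε).le fun x hx => hz (θ, x) ⟨hθ, hx⟩
  linarith

lemma withExpHighProbability_objective_close (hK : IsCompact K) (hQK : ∀ᵐ x ∂Q, x ∈ K)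
    {μ : Measure ℝ} (hμ : KernelMeasure μ) (q : ℕ) {Θ : Set (EuclideanSpace ℝ (Fin p))}
    (hΘ : IsCompact Θ) {ε : ℝ} (hε : 0 < ε) :
    WithExpHighProbability Q fun _ z => ∀ β ∈ Θ,
      |objective q μ (empiricalMeasure z) β - objective q μ Q β| ≤ ε ∧
      ∀ l, |objectiveSlope q μ (empiricalMeasure z) l β - objectiveSlope q μ Q l β| ≤ ε := by
  have hvalue := withExpHighProbability_forall_abs_integral_empiricalMeasure_prod_sub_le hΘ hK hQK
    (continuous_valueKernel hμ q) (valueKernel_comm q) hε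
  have hslope := WithExpHighProbability.forall_of_finite fun l : Fin p =>
    withExpHighProbability_forall_abs_integral_empiricalMeasure_prod_sub_le hΘ hK hQK
      (continuous_slopeKernel hμ q l) (slopeKernel_comm q l) hε
  refine (hvalue.and hslope).mono <| .of_forall fun n z ⟨hv, hs⟩ β hβ => ⟨?_, fun l => hs l β hβ⟩
  rw [objective_eq_neg_integral_valueKernel, objective_eq_neg_integral_valueKernel, neg_sub_neg,
    abs_sub_comm]
  exact hv β hβ

end EmpiricalConcentration

/-! ### Convolution roots of exponential kernels -/

section ConvolutionRoot

/-- `ψ` is a convolution square root of the translation invariant kernel `k (x - x')`: this kernel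
is the superposition over `u` of the rank one kernels `ψ (x - u) * ψ (x' - u)`. Moreover `ψ` is
nonnegative, bounded, integrable, and its Fourier transform (written with the characters
`s ↦ exp (i L s)`, `L` in the dual of `V`) has no zeros. -/
structure ConvolutionRoot {V : Type*} [NormedAddCommGroup V] [NormedSpace ℝ V] [MeasureSpace V]
    (ψ k : V → ℝ) : Prop where
  measurable : Measurable ψ
  integrable : Integrable ψ
  nonneg : ∀ s, 0 ≤ ψ s
  bounded : ∃ C, ∀ s, ψ s ≤ C
  convolution : ∀ x x', ∫ u, ψ (x - u) * ψ (x' - u) = k (x - x')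
  fourier_ne_zero : ∀ L : StrongDual ℝ V, ∫ s, Complex.exp (L s * Complex.I) * (ψ s : ℂ) ≠ 0

section Pi

variable {ι : Type*} [Fintype ι] {ψ k : ι → ℝ → ℝ}

lemma integral_exp_mul_prod (ψ : ι → ℝ → ℝ) (L : StrongDual ℝ (ι → ℝ)) [DecidableEq ι] :
    ∫ s : ι → ℝ, Complex.exp (L s * Complex.I) * ((∏ i, ψ i (s i) : ℝ) : ℂ) =
      ∏ i, ∫ u : ℝ, Complex.exp ((L.comp (.single ℝ _ i)) u * Complex.I) * (ψ i u : ℂ) := by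
  rw [← integral_fintype_prod_volume_eq_prod fun i (u : ℝ) =>
    Complex.exp ((L.comp (.single ℝ _ i)) u * Complex.I) * (ψ i u : ℂ)]
  congr with s
  rw [Finset.prod_mul_distrib, ← Complex.exp_sum, ← Finset.sum_mul, ← Complex.ofReal_sum,
    L.sum_comp_single, Complex.ofReal_prod]

lemma ConvolutionRoot.pi (h : ∀ i, ConvolutionRoot (ψ i) (k i)) :
    ConvolutionRoot (fun s : ι → ℝ => ∏ i, ψ i (s i)) (fun s => ∏ i, k i (s i)) where
  measurable := Finset.measurable_prod _ fun i _ => (h i).measurable.comp (measurable_pi_apply i)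
  integrable := Integrable.fintype_prod fun i => (h i).integrable
  nonneg s := Finset.prod_nonneg fun i _ => (h i).nonneg _
  bounded := by
    choose C hC using fun i => (h i).bounded
    exact ⟨∏ i, C i, fun s => Finset.prod_le_prod (fun i _ => (h i).nonneg _) fun i _ => hC i _⟩
  convolution x x' := by
    simp only [← Finset.prod_mul_distrib, Pi.sub_apply]
    rw [integral_fintype_prod_volume_eq_prod (fun i u => ψ i (x i - u) * ψ i (x' i - u))]
    exact Finset.prod_congr rfl fun i _ => (h i).convolution _ _
  fourier_ne_zero L := by
    classical
    rw [integral_exp_mul_prod]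
    exact Finset.prod_ne_zero_iff.2 fun i _ => (h i).fourier_ne_zero _

end Pi

lemma strongDual_real_apply (L : StrongDual ℝ ℝ) (s : ℝ) : L s = L 1 * s := by
  simpa [mul_comm] using L.map_smul s 1

section Gaussian

/-- The convolution root of the Gaussian kernel `exp (-b * (x - x') ^ 2)`. -/
def gaussianRoot (b s : ℝ) : ℝ := √√(4 * b / Real.pi) * Real.exp (-(2 * b) * s ^ 2)

variable {b : ℝ}

lemma integral_gaussianRoot_mul_gaussianRoot (hb : 0 < b) (x x' : ℝ) :
    ∫ u, gaussianRoot b (x - u) * gaussianRoot b (x' - u) = Real.exp (-(b * (x - x') ^ 2)) := by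
  have hsquare (u : ℝ) : gaussianRoot b (x - u) * gaussianRoot b (x' - u) =
      (√(4 * b / Real.pi) * Real.exp (-(b * (x - x') ^ 2))) *
        Real.exp (-(4 * b) * (u - (x + x') / 2) ^ 2) := by
    rw [gaussianRoot, gaussianRoot, mul_mul_mul_comm, Real.mul_self_sqrt (Real.sqrt_nonneg _),
      ← Real.exp_add, mul_assoc, ← Real.exp_add]
    congr 2
    ring
  have hconst : 4 * b / Real.pi * (Real.pi / (4 * b)) = 1 := by
    field_simp [Real.pi_ne_zero]
  simp only [hsquare]
  rw [integral_const_mul, integral_sub_right_eq_self (fun u => Real.exp (-(4 * b) * u ^ 2)),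
    integral_gaussian, mul_right_comm, ← Real.sqrt_mul (by positivity), hconst, Real.sqrt_one,
    one_mul]

lemma fourier_gaussianRoot_ne_zero (hb : 0 < b) (ξ : ℝ) :
    ∫ s : ℝ, Complex.exp ((ξ * s : ℝ) * Complex.I) * (gaussianRoot b s : ℂ) ≠ 0 := by
  have hintegrand (s : ℝ) :
      Complex.exp ((ξ * s : ℝ) * Complex.I) * (gaussianRoot b s : ℂ) =
        ((√√(4 * b / Real.pi) : ℝ) : ℂ) * (Complex.exp (Complex.I * ξ * s) *
          Complex.exp (-((2 * b : ℝ) : ℂ) * s ^ 2)) := by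
    push_cast [gaussianRoot]
    ring_nf
  have hroot : √√(4 * b / Real.pi) ≠ 0 := by positivity
  simp only [hintegrand]
  rw [integral_const_mul, fourierIntegral_gaussian (by simpa using hb)]
  refine mul_ne_zero (by exact_mod_cast hroot) (mul_ne_zero ?_ (Complex.exp_ne_zero _))
  rw [Ne, Complex.cpow_eq_zero_iff]
  simp [Real.pi_ne_zero, hb.ne']

lemma convolutionRoot_gaussianRoot (hb : 0 < b) :
    ConvolutionRoot (gaussianRoot b) fun s => Real.exp (-(b * s ^ 2)) where
  measurable := by unfold gaussianRoot; fun_prop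
  integrable := (integrable_exp_neg_mul_sq (by positivity)).const_mul _
  nonneg s := by unfold gaussianRoot; positivity
  bounded := ⟨√√(4 * b / Real.pi), fun s => mul_le_of_le_one_right (by positivity)
    (Real.exp_le_one_iff.2 (by nlinarith [mul_nonneg hb.le (sq_nonneg s)]))⟩
  convolution := integral_gaussianRoot_mul_gaussianRoot hb
  fourier_ne_zero L := by
    have hL : ⇑L = fun s => L 1 * s := funext (strongDual_real_apply L)
    exact hL ▸ fourier_gaussianRoot_ne_zero hb (L 1)

end Gaussian

section Exponential

/-- The convolution root of the Laplace kernel `exp (-b * |x - x'|)`. -/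
def exponentialRoot (b : ℝ) : ℝ → ℝ := (Ici 0).indicator fun s => √(2 * b) * Real.exp (-b * s)

variable {b : ℝ}

lemma exponentialRoot_mul_exponentialRoot (hb : 0 < b) (x x' u : ℝ) :
    exponentialRoot b (x - u) * exponentialRoot b (x' - u) =
      (Iic (min x x')).indicator
        (fun u => 2 * b * Real.exp (-b * (x + x')) * Real.exp (2 * b * u)) u := by
  simp only [exponentialRoot, indicator_apply, mem_Ici, mem_Iic, sub_nonneg, le_min_iff]
  by_cases hx : u ≤ x <;> by_cases hx' : u ≤ x' <;> simp only [hx, hx', if_true, if_false,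
    and_self, and_true, and_false, mul_zero, zero_mul]
  rw [mul_mul_mul_comm, Real.mul_self_sqrt (by positivity), ← Real.exp_add, mul_assoc (2 * b),
    ← Real.exp_add]
  ring_nf

lemma integral_exponentialRoot_mul_exponentialRoot (hb : 0 < b) (x x' : ℝ) :
    ∫ u, exponentialRoot b (x - u) * exponentialRoot b (x' - u) = Real.exp (-(b * |x - x'|)) := by
  have habs : 2 * min x x' = x + x' - |x - x'| := by
    rw [← max_sub_min_eq_abs', ← min_add_max x x']
    ring
  simp only [exponentialRoot_mul_exponentialRoot hb]
  rw [integral_indicator measurableSet_Iic, integral_const_mul,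
    integral_exp_mul_Iic (by positivity), mul_comm (2 * b), mul_assoc,
    mul_div_cancel₀ _ (by positivity), ← Real.exp_add, mul_comm 2 b, mul_assoc, habs]
  ring_nf

lemma fourier_exponentialRoot_ne_zero (hb : 0 < b) (ξ : ℝ) :
    ∫ s : ℝ, Complex.exp ((ξ * s : ℝ) * Complex.I) * (exponentialRoot b s : ℂ) ≠ 0 := by
  have hintegrand (s : ℝ) :
      Complex.exp ((ξ * s : ℝ) * Complex.I) * (exponentialRoot b s : ℂ) =
        (Ici 0).indicator (fun s : ℝ => ((√(2 * b) : ℝ) : ℂ) *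
          Complex.exp ((-(b : ℂ) + ξ * Complex.I) * s)) s := by
    by_cases hs : s ∈ Ici (0 : ℝ)
    · simp only [exponentialRoot, indicator_of_mem hs, add_mul, Complex.exp_add]
      push_cast
      ring_nf
    · simp only [exponentialRoot, indicator_of_notMem hs, Complex.ofReal_zero, mul_zero]
  have hre : (-(b : ℂ) + ξ * Complex.I).re < 0 := by simpa using hb
  have hexponent : -(b : ℂ) + ξ * Complex.I ≠ 0 := fun h => by simp [h] at hre
  have hroot : √(2 * b) ≠ 0 := by positivity
  simp only [hintegrand]
  rw [integral_indicator measurableSet_Ici, integral_const_mul, integral_Ici_eq_integral_Ioi,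
    integral_exp_mul_complex_Ioi hre]
  exact mul_ne_zero (by exact_mod_cast hroot)
    (div_ne_zero (neg_ne_zero.2 (Complex.exp_ne_zero _)) hexponent)

lemma convolutionRoot_exponentialRoot (hb : 0 < b) :
    ConvolutionRoot (exponentialRoot b) fun s => Real.exp (-(b * |s|)) where
  measurable := Measurable.indicator (by fun_prop) measurableSet_Ici
  integrable := by
    rw [exponentialRoot, integrable_indicator_iff measurableSet_Ici,
      integrableOn_Ici_iff_integrableOn_Ioi]
    exact (integrableOn_exp_mul_Ioi (by linarith) 0).const_mul _
  nonneg s := indicator_nonneg (fun _ _ => by positivity) _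
  bounded := ⟨√(2 * b), indicator_le' (fun s (hs : 0 ≤ s) =>
    mul_le_of_le_one_right (by positivity) (Real.exp_le_one_iff.2 (by nlinarith)))
    fun _ _ => by positivity⟩
  convolution := integral_exponentialRoot_mul_exponentialRoot hb
  fourier_ne_zero L := by
    have hL : ⇑L = fun s => L 1 * s := funext (strongDual_real_apply L)
    exact hL ▸ fourier_exponentialRoot_ne_zero hb (L 1)

end Exponential

/-- The kernel `exp (-∑ i, b i * |s i| ^ q)` of the difference `s` of two feature vectors. -/
def expKernel {ι : Type*} [Fintype ι] (q : ℕ) (b s : ι → ℝ) : ℝ :=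
  Real.exp (-∑ i, b i * |s i| ^ q)

lemma exists_convolutionRoot_expKernel {ι : Type*} [Fintype ι] {q : ℕ} (hq : q = 1 ∨ q = 2)
    {b : ι → ℝ} (hb : ∀ i, 0 < b i) : ∃ ψ, ConvolutionRoot ψ (expKernel q b) := by
  have hcoord (i : ι) : ∃ ψ : ℝ → ℝ, ConvolutionRoot ψ fun s => Real.exp (-(b i * |s| ^ q)) := by
    rcases hq with rfl | rfl
    · exact ⟨_, by simpa only [pow_one] using convolutionRoot_exponentialRoot (hb i)⟩
    · exact ⟨_, by simpa only [sq_abs] using convolutionRoot_gaussianRoot (hb i)⟩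
  choose ψ hψ using hcoord
  refine ⟨fun s => ∏ i, ψ i (s i), ?_⟩
  unfold expKernel
  simpa only [← Real.exp_sum, Finset.sum_neg_distrib] using ConvolutionRoot.pi hψ

end ConvolutionRoot

/-! ### Positive definiteness -/

section Translate

variable {V : Type*} [NormedAddCommGroup V] [NormedSpace ℝ V] [MeasureSpace V] [BorelSpace V]
  [(volume : Measure V).IsAddLeftInvariant] [(volume : Measure V).IsNegInvariant]

lemma integral_exp_mul_translate (ψ : V → ℝ) (x : V) (y : ℝ) (L : StrongDual ℝ V) :
    ∫ u, Complex.exp (L u * Complex.I) * ((y * ψ (x - u) : ℝ) : ℂ) =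
      Complex.exp (L x * Complex.I) * y *
        ∫ s, Complex.exp ((-L) s * Complex.I) * (ψ s : ℂ) := by
  have hcharacter (u : V) : Complex.exp (L u * Complex.I) =
      Complex.exp (L x * Complex.I) * Complex.exp ((-L) (x - u) * Complex.I) := by
    rw [← Complex.exp_add, ← add_mul, ← Complex.ofReal_add]
    simp
  rw [← integral_sub_left_eq_self (fun s => Complex.exp ((-L) s * Complex.I) * (ψ s : ℂ)) volume x,
    ← integral_const_mul]
  congr with u
  rw [hcharacter, Complex.ofReal_mul]
  ring

end Translate

section PairForm

variable {Ω : Type*} [MeasurableSpace Ω]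

/-- The quadratic form `E [Y Y' K]` of a kernel `K` on pairs, where `Y'` is the value of `Y` at an
independent copy of the sample point. -/
def pairForm (P : Measure Ω) (Y : Ω → ℝ) (K : Ω → Ω → ℝ) : ℝ :=
  ∫ w, Y w.1 * Y w.2 * K w.1 w.2 ∂(P.prod P)

variable {V : Type*} [NormedAddCommGroup V] [NormedSpace ℝ V] [MeasureSpace V] [BorelSpace V]
  [SecondCountableTopology V] [SFinite (volume : Measure V)]
  [(volume : Measure V).IsAddLeftInvariant] [(volume : Measure V).IsNegInvariant]
  {P : Measure Ω} {X : Ω → V} {Y : Ω → ℝ} {ψ k : V → ℝ}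

namespace ConvolutionRoot

lemma integrable_mul_translate [SFinite P] (h : ConvolutionRoot ψ k) (hX : Measurable X)
    (hY : Integrable Y P) :
    Integrable (fun w : Ω × V => Y w.1 * ψ (X w.1 - w.2)) (P.prod volume) := by
  have hψX : Measurable fun w : Ω × V => ψ (X w.1 - w.2) := h.measurable.comp (by fun_prop)
  have hmeas : AEStronglyMeasurable (fun w : Ω × V => Y w.1 * ψ (X w.1 - w.2))
      (P.prod volume) := hY.aestronglyMeasurable.comp_fst.mul hψX.aestronglyMeasurable
  rw [integrable_prod_iff hmeas]
  refine ⟨ae_of_all _ fun ω => (h.integrable.comp_sub_left (X ω)).const_mul (Y ω), ?_⟩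
  have hnorm (ω : Ω) : ∫ u, ‖Y ω * ψ (X ω - u)‖ = ‖Y ω‖ * ∫ u, ‖ψ u‖ := by
    simp only [norm_mul]
    rw [integral_const_mul, integral_sub_left_eq_self fun u => ‖ψ u‖]
  simpa only [hnorm] using hY.norm.mul_const _

lemma integrable_pair_mul_translate [SFinite P] (h : ConvolutionRoot ψ k) (hX : Measurable X)
    (hY : Integrable Y P) :
    Integrable (fun w : (Ω × Ω) × V =>
      Y w.1.1 * ψ (X w.1.1 - w.2) * (Y w.1.2 * ψ (X w.1.2 - w.2))) ((P.prod P).prod volume) := by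
  obtain ⟨C, hC⟩ := h.bounded
  have hbounded := h.integrable_mul_translate (X := X ∘ Prod.fst) (by fun_prop) (hY.mul_prod hY)
  have hψX : Measurable fun w : (Ω × Ω) × V => ψ (X w.1.2 - w.2) := h.measurable.comp (by fun_prop)
  refine (hbounded.mul_bdd (c := C) hψX.aestronglyMeasurable (ae_of_all _ fun w => ?_)).congr
    (ae_of_all _ fun w => by simp only [Function.comp_apply]; ring)
  exact (Real.norm_of_nonneg (h.nonneg _)).trans_le (hC _)

end ConvolutionRoot

/-- The mean `E [Y ψ (X - u)]` of the response against the translate by `u` of a root `ψ`. -/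
def rootMean (P : Measure Ω) (X : Ω → V) (Y : Ω → ℝ) (ψ : V → ℝ) (u : V) : ℝ :=
  ∫ ω, Y ω * ψ (X ω - u) ∂P

namespace ConvolutionRoot

lemma integrable_rootMean_sq [SFinite P] (h : ConvolutionRoot ψ k) (hX : Measurable X)
    (hY : Integrable Y P) : Integrable fun u => rootMean P X Y ψ u ^ 2 := by
  simpa only [pow_two, rootMean, ← integral_prod_mul] using
    (h.integrable_pair_mul_translate hX hY).integral_prod_right

lemma pairForm_eq_integral_rootMean_sq [SFinite P] (h : ConvolutionRoot ψ k) (hX : Measurable X)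
    (hY : Integrable Y P) :
    pairForm P Y (fun ω ω' => k (X ω - X ω')) = ∫ u, rootMean P X Y ψ u ^ 2 := by
  have hsuperposition (w : Ω × Ω) : Y w.1 * Y w.2 * k (X w.1 - X w.2) =
      ∫ u, Y w.1 * ψ (X w.1 - u) * (Y w.2 * ψ (X w.2 - u)) := by
    rw [← h.convolution, ← integral_const_mul]
    congr with u
    ring
  simp only [pairForm, hsuperposition, pow_two, rootMean, ← integral_prod_mul]
  exact integral_integral_swap (h.integrable_pair_mul_translate hX hY)

lemma integrable_exp_mul_translate [SFinite P] (h : ConvolutionRoot ψ k) (hX : Measurable X)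
    (hY : Integrable Y P) (L : StrongDual ℝ V) :
    Integrable (fun w : Ω × V =>
      Complex.exp (L w.2 * Complex.I) * ((Y w.1 * ψ (X w.1 - w.2) : ℝ) : ℂ))
      (P.prod volume) :=
  (h.integrable_mul_translate hX hY).ofReal.bdd_mul (c := 1)
    (by fun_prop) (ae_of_all _ fun w => (Complex.norm_exp_ofReal_mul_I _).le)

lemma fourier_eq_zero [SFinite P] (h : ConvolutionRoot ψ k) (hX : Measurable X)
    (hY : Integrable Y P) (hroot : rootMean P X Y ψ =ᵐ[volume] 0) (L : StrongDual ℝ V) :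
    ∫ ω, Complex.exp (L (X ω) * Complex.I) * Y ω ∂P = 0 := by
  have hfourier_root : ∫ u, Complex.exp (L u * Complex.I) * (rootMean P X Y ψ u : ℂ) = 0 :=
    integral_eq_zero_of_ae (hroot.mono fun u hu => by simp [hu])
  have hswap := integral_integral_swap
    (f := fun ω u => Complex.exp (L u * Complex.I) * ((Y ω * ψ (X ω - u) : ℝ) : ℂ))
    (h.integrable_exp_mul_translate hX hY L)
  simp only [integral_exp_mul_translate ψ, integral_mul_const, integral_const_mul,
    integral_complex_ofReal] at hswap
  exact (mul_eq_zero.1 (hswap.trans hfourier_root)).resolve_right (h.fourier_ne_zero (-L))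

end ConvolutionRoot

end PairForm

section FourierUniqueness

variable {Ω V : Type*} [mΩ : MeasurableSpace Ω] [NormedAddCommGroup V] [NormedSpace ℝ V]
  [mV : MeasurableSpace V] [BorelSpace V] [SecondCountableTopology V] {P : Measure Ω}
  {X : Ω → V} {Y : Ω → ℝ}

lemma integrable_exp_mul (hX : Measurable X) (hY : Integrable Y P) (L : StrongDual ℝ V) :
    Integrable (fun ω => Complex.exp (L (X ω) * Complex.I) * Y ω) P :=
  hY.ofReal.bdd_mul (c := 1) (by fun_prop)
    (ae_of_all _ fun ω => (Complex.norm_exp_ofReal_mul_I _).le)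

omit [SecondCountableTopology V] in
lemma charFunDual_map_withDensity_ofReal (hX : Measurable X) (hYm : Measurable Y)
    (L : StrongDual ℝ V) :
    charFunDual ((P.withDensity fun ω => ENNReal.ofReal (Y ω)).map X) L =
      ∫ ω, Complex.exp (L (X ω) * Complex.I) * (max (Y ω) 0 : ℝ) ∂P := by
  rw [charFunDual_apply, integral_map (by fun_prop) (by fun_prop),
    integral_withDensity_eq_integral_toReal_smul (by fun_prop) (by simp)]
  simp only [ENNReal.toReal_ofReal', Complex.real_smul, mul_comm]

lemma map_withDensity_ofReal_eq_of_fourier_eq_zero [CompleteSpace V] (hX : Measurable X)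
    (hYm : Measurable Y) (hY : Integrable Y P)
    (hfourier : ∀ L : StrongDual ℝ V, ∫ ω, Complex.exp (L (X ω) * Complex.I) * Y ω ∂P = 0) :
    (P.withDensity fun ω => ENNReal.ofReal (Y ω)).map X =
      (P.withDensity fun ω => ENNReal.ofReal (-Y ω)).map X := by
  have := isFiniteMeasure_withDensity_ofReal hY.2
  have := isFiniteMeasure_withDensity_ofReal hY.neg.2
  refine Measure.ext_of_charFunDual (funext fun L => sub_eq_zero.1 ?_)
  rw [charFunDual_map_withDensity_ofReal hX hYm, charFunDual_map_withDensity_ofReal hX hYm.fun_neg,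
    ← integral_sub (integrable_exp_mul hX hY.pos_part L) (integrable_exp_mul hX hY.neg_part L),
    ← hfourier L]
  congr with ω
  rw [← mul_sub, ← Complex.ofReal_sub, max_zero_sub_max_neg_zero_eq_self]

lemma condExp_comap_eq_zero_of_fourier_eq_zero [CompleteSpace V] [IsFiniteMeasure P]
    (hX : Measurable X) (hYm : Measurable Y) (hY : Integrable Y P)
    (hfourier : ∀ L : StrongDual ℝ V, ∫ ω, Complex.exp (L (X ω) * Complex.I) * Y ω ∂P = 0) :
    P[Y | mV.comap X] =ᵐ[P] 0 := by
  refine (ae_eq_condExp_of_forall_setIntegral_eq hX.comap_le hY (fun _ _ _ => integrableOn_zero)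
    ?_ aestronglyMeasurable_zero).symm
  rintro _ ⟨A, hA, rfl⟩ -
  have hdensity := congrArg (fun ν => ν A)
    (map_withDensity_ofReal_eq_of_fourier_eq_zero hX hYm hY hfourier)
  simp only [Measure.map_apply hX hA, withDensity_apply _ (hX hA)] at hdensity
  rw [integral_eq_lintegral_pos_part_sub_lintegral_neg_part hY.integrableOn, hdensity, sub_self]
  simp

end FourierUniqueness

section ExponentialKernel

variable {Ω ι : Type*} [MeasurableSpace Ω] [Fintype ι] {P : Measure Ω} {X : Ω → ι → ℝ}
  {Y : Ω → ℝ} {q : ℕ} {b : ι → ℝ}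

lemma expKernel_le_one (hb : ∀ i, 0 ≤ b i) (s : ι → ℝ) : expKernel q b s ≤ 1 :=
  Real.exp_le_one_iff.2 (neg_nonpos.2 (Finset.sum_nonneg fun i _ =>
    mul_nonneg (hb i) (by positivity)))

lemma abs_expKernel_le_one (hb : ∀ i, 0 ≤ b i) (s : ι → ℝ) : |expKernel q b s| ≤ 1 :=
  (Real.abs_exp _).trans_le (expKernel_le_one hb s)

lemma continuous_expKernel (q : ℕ) :
    Continuous fun x : (ι → ℝ) × (ι → ℝ) => expKernel q x.1 x.2 := by
  unfold expKernel
  fun_prop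

lemma measurable_expKernel (q : ℕ) (b : ι → ℝ) : Measurable (expKernel q b) :=
  ((continuous_expKernel q).comp (Continuous.prodMk_right b)).measurable

lemma tendsto_pairForm_expKernel [SFinite P] (hX : Measurable X) (hY : Integrable Y P)
    {c : ℕ → ι → ℝ} (hc : ∀ n i, 0 ≤ c n i) (hcb : Tendsto c atTop (𝓝 b)) :
    Tendsto (fun n => pairForm P Y fun ω ω' => expKernel q (c n) (X ω - X ω')) atTop
      (𝓝 (pairForm P Y fun ω ω' => expKernel q b (X ω - X ω'))) := by
  have hYY := hY.mul_prod hY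
  refine tendsto_integral_of_dominated_convergence (fun w => ‖Y w.1 * Y w.2‖)
    (fun n => hYY.aestronglyMeasurable.mul
      ((measurable_expKernel q (c n)).comp (by fun_prop)).aestronglyMeasurable)
    hYY.norm (fun n => ae_of_all _ fun w => ?_) (ae_of_all _ fun w => ?_)
  · rw [norm_mul]
    exact mul_le_of_le_one_right (norm_nonneg _) (abs_expKernel_le_one (hc n) _)
  · exact (((continuous_expKernel q).tendsto (b, X w.1 - X w.2)).comp
      (hcb.prodMk_nhds tendsto_const_nhds)).const_mul _

lemma pairForm_expKernel_nonneg [SFinite P] (hq : q = 1 ∨ q = 2) (hX : Measurable X)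
    (hY : Integrable Y P) (hb : ∀ i, 0 ≤ b i) :
    0 ≤ pairForm P Y fun ω ω' => expKernel q b (X ω - X ω') := by
  have hpos (n : ℕ) (i : ι) : 0 < b i + 1 / ((n : ℝ) + 1) := add_pos_of_nonneg_of_pos (hb i)
    Nat.one_div_pos_of_nat
  have hlim : Tendsto (fun (n : ℕ) i => b i + 1 / ((n : ℝ) + 1)) atTop (𝓝 b) :=
    tendsto_pi_nhds.2 fun i => by
      simpa using tendsto_one_div_add_atTop_nhds_zero_nat.const_add (b i)
  refine ge_of_tendsto'
    (tendsto_pairForm_expKernel hX hY (fun n i => (hpos n i).le) hlim) fun n => ?_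
  obtain ⟨ψ, hψ⟩ := exists_convolutionRoot_expKernel hq (hpos n)
  rw [hψ.pairForm_eq_integral_rootMean_sq hX hY]
  exact integral_nonneg fun u => sq_nonneg _

lemma pairForm_expKernel_pos [IsFiniteMeasure P] (hq : q = 1 ∨ q = 2) (hX : Measurable X)
    (hYm : Measurable Y) (hY : Integrable Y P) (hb : ∀ i, 0 < b i)
    (hXY : ¬ P[Y | MeasurableSpace.comap X inferInstance] =ᵐ[P] 0) :
    0 < pairForm P Y fun ω ω' => expKernel q b (X ω - X ω') := by
  refine (pairForm_expKernel_nonneg hq hX hY fun i => (hb i).le).lt_of_ne' fun hzero => hXY ?_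
  obtain ⟨ψ, hψ⟩ := exists_convolutionRoot_expKernel hq hb
  rw [hψ.pairForm_eq_integral_rootMean_sq hX hY,
    integral_eq_zero_iff_of_nonneg (fun u => sq_nonneg _) (hψ.integrable_rootMean_sq hX hY)]
    at hzero
  exact condExp_comap_eq_zero_of_fourier_eq_zero hX hYm hY
    (hψ.fourier_eq_zero hX hY (hzero.mono fun u hu => pow_eq_zero_iff two_ne_zero |>.1 hu))

end ExponentialKernel

/-! ### Maximal correlation -/

section MaximalCorrelation

variable {Ω α₁ α₂ : Type*} [MeasurableSpace Ω] [MeasurableSpace α₁] [MeasurableSpace α₂]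
  {P : Measure Ω} {W₁ : Ω → α₁} {W₂ : Ω → α₂}

/-- The correlations of square integrable, nonconstant functions of `W₁` and `W₂`; their supremum
is the maximal correlation. -/
def correlations (P : Measure Ω) (W₁ : Ω → α₁) (W₂ : Ω → α₂) : Set ℝ :=
  {r | ∃ (g₁ : α₁ → ℝ) (g₂ : α₂ → ℝ), Measurable g₁ ∧ Measurable g₂ ∧
    MemLp (fun ω => g₁ (W₁ ω)) 2 P ∧ MemLp (fun ω => g₂ (W₂ ω)) 2 P ∧
    0 < Var[fun ω => g₁ (W₁ ω); P] ∧ 0 < Var[fun ω => g₂ (W₂ ω); P] ∧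
    r = cov[fun ω => g₁ (W₁ ω), fun ω => g₂ (W₂ ω); P] /
      √(Var[fun ω => g₁ (W₁ ω); P] * Var[fun ω => g₂ (W₂ ω); P])}

lemma neg_mem_correlations {r : ℝ} (hr : r ∈ correlations P W₁ W₂) :
    -r ∈ correlations P W₁ W₂ := by
  obtain ⟨g₁, g₂, hm₁, hm₂, hL₁, hL₂, hv₁, hv₂, rfl⟩ := hr
  refine ⟨fun x => -g₁ x, g₂, hm₁.neg, hm₂, hL₁.neg, hL₂, ?_, hv₂, ?_⟩
  · rwa [variance_fun_neg]
  · rw [covariance_fun_neg_left, variance_fun_neg, neg_div]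

lemma maximalCorrelation_nonneg (P : Measure Ω) (W₁ : Ω → α₁) (W₂ : Ω → α₂) :
    0 ≤ maximalCorrelation P W₁ W₂ := by
  refine (correlations P W₁ W₂).eq_empty_or_nonempty.elim (fun h => ?_) fun ⟨r, hr⟩ => ?_
  · exact (Real.sSup_empty.symm.trans (congrArg sSup h.symm)).le
  · exact Real.sSup_nonneg' ((le_total 0 r).elim (fun h => ⟨r, hr, h⟩)
      fun h => ⟨-r, neg_mem_correlations hr, neg_nonneg.2 h⟩)

variable [IsProbabilityMeasure P]

lemma covariance_sq_le {X Y : Ω → ℝ} (hX : MemLp X 2 P) (hY : MemLp Y 2 P) :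
    cov[X, Y; P] ^ 2 ≤ Var[X; P] * Var[Y; P] := by
  have hquadratic (c : ℝ) : 0 ≤ Var[Y; P] * (c * c) + 2 * cov[X, Y; P] * c + Var[X; P] := by
    have hvar := variance_nonneg (X + c • Y) P
    rw [variance_add hX (hY.const_smul c), variance_smul, covariance_smul_right] at hvar
    linarith
  have hdiscrim := discrim_le_zero hquadratic
  rw [discrim] at hdiscrim
  linarith

lemma abs_covariance_le_sqrt {X Y : Ω → ℝ} (hX : MemLp X 2 P) (hY : MemLp Y 2 P) :
    |cov[X, Y; P]| ≤ √(Var[X; P] * Var[Y; P]) :=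
  Real.abs_le_sqrt (covariance_sq_le hX hY)

lemma bddAbove_correlations (P : Measure Ω) [IsProbabilityMeasure P] (W₁ : Ω → α₁)
    (W₂ : Ω → α₂) : BddAbove (correlations P W₁ W₂) := by
  refine ⟨1, ?_⟩
  rintro r ⟨g₁, g₂, -, -, hL₁, hL₂, -, -, rfl⟩
  exact div_le_one_of_le₀ ((le_abs_self _).trans (abs_covariance_le_sqrt hL₁ hL₂))
    (Real.sqrt_nonneg _)

lemma abs_le_maximalCorrelation {r : ℝ} (hr : r ∈ correlations P W₁ W₂) :
    |r| ≤ maximalCorrelation P W₁ W₂ :=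
  abs_le'.2 ⟨le_csSup (bddAbove_correlations P W₁ W₂) hr,
    le_csSup (bddAbove_correlations P W₁ W₂) (neg_mem_correlations hr)⟩

lemma abs_covariance_le_maximalCorrelation {g₁ : α₁ → ℝ} {g₂ : α₂ → ℝ} (hm₁ : Measurable g₁)
    (hm₂ : Measurable g₂) (hL₁ : MemLp (fun ω => g₁ (W₁ ω)) 2 P)
    (hL₂ : MemLp (fun ω => g₂ (W₂ ω)) 2 P) :
    |cov[fun ω => g₁ (W₁ ω), fun ω => g₂ (W₂ ω); P]| ≤ maximalCorrelation P W₁ W₂ *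
      √(Var[fun ω => g₁ (W₁ ω); P] * Var[fun ω => g₂ (W₂ ω); P]) := by
  rcases (mul_nonneg (variance_nonneg (fun ω => g₁ (W₁ ω)) P)
    (variance_nonneg (fun ω => g₂ (W₂ ω)) P)).eq_or_lt with hzero | hpos
  · simpa [← hzero] using abs_covariance_le_sqrt hL₁ hL₂
  · have hv₁ := pos_of_mul_pos_left hpos (variance_nonneg _ _)
    have hv₂ := pos_of_mul_pos_right hpos (variance_nonneg _ _)
    have hcorr := abs_le_maximalCorrelation (P := P) (W₁ := W₁) (W₂ := W₂)
      ⟨g₁, g₂, hm₁, hm₂, hL₁, hL₂, hv₁, hv₂, rfl⟩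
    rwa [abs_div, abs_of_nonneg (Real.sqrt_nonneg _), div_le_iff₀ (Real.sqrt_pos.2 hpos)] at hcorr

lemma variance_le_sq_of_ae_abs_le {X : Ω → ℝ} {B : ℝ} (hX : AEMeasurable X P)
    (hB : ∀ᵐ ω ∂P, |X ω| ≤ B) : Var[X; P] ≤ B ^ 2 :=
  (variance_le_sq_of_bounded (hB.mono fun _ h => abs_le.1 h) hX).trans_eq (by ring)

lemma nonneg_of_ae_abs_le {X : Ω → ℝ} {B : ℝ} (hB : ∀ᵐ ω ∂P, |X ω| ≤ B) : 0 ≤ B :=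
  hB.exists.elim fun _ h => (abs_nonneg _).trans h

lemma abs_integral_mul_sub_le_maximalCorrelation {g₁ : α₁ → ℝ} {g₂ : α₂ → ℝ} {B₁ B₂ : ℝ}
    (hW₁ : Measurable W₁) (hW₂ : Measurable W₂) (hm₁ : Measurable g₁) (hm₂ : Measurable g₂)
    (hB₁ : ∀ᵐ ω ∂P, |g₁ (W₁ ω)| ≤ B₁) (hB₂ : ∀ᵐ ω ∂P, |g₂ (W₂ ω)| ≤ B₂) :
    |∫ ω, g₁ (W₁ ω) * g₂ (W₂ ω) ∂P - (∫ ω, g₁ (W₁ ω) ∂P) * ∫ ω, g₂ (W₂ ω) ∂P| ≤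
      maximalCorrelation P W₁ W₂ * (B₁ * B₂) := by
  have hL₁ : MemLp (fun ω => g₁ (W₁ ω)) 2 P :=
    MemLp.of_bound (hm₁.comp hW₁).aestronglyMeasurable B₁ hB₁
  have hL₂ : MemLp (fun ω => g₂ (W₂ ω)) 2 P :=
    MemLp.of_bound (hm₂.comp hW₂).aestronglyMeasurable B₂ hB₂
  have hsqrt : √(Var[fun ω => g₁ (W₁ ω); P] * Var[fun ω => g₂ (W₂ ω); P]) ≤ B₁ * B₂ := by
    refine Real.sqrt_le_iff.2 ⟨mul_nonneg (nonneg_of_ae_abs_le hB₁) (nonneg_of_ae_abs_le hB₂), ?_⟩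
    rw [mul_pow]
    exact mul_le_mul (variance_le_sq_of_ae_abs_le (hm₁.comp hW₁).aemeasurable hB₁)
      (variance_le_sq_of_ae_abs_le (hm₂.comp hW₂).aemeasurable hB₂) (variance_nonneg _ _)
      (sq_nonneg _)
  rw [show ∫ ω, g₁ (W₁ ω) * g₂ (W₂ ω) ∂P - (∫ ω, g₁ (W₁ ω) ∂P) * ∫ ω, g₂ (W₂ ω) ∂P =
    cov[fun ω => g₁ (W₁ ω), fun ω => g₂ (W₂ ω); P] from (covariance_eq_sub hL₁ hL₂).symm]
  exact (abs_covariance_le_maximalCorrelation hm₁ hm₂ hL₁ hL₂).trans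
    (mul_le_mul_of_nonneg_left hsqrt (maximalCorrelation_nonneg P W₁ W₂))

end MaximalCorrelation

/-! ### Decoupling -/

section Regression

variable {Ω E : Type*} [MeasurableSpace Ω] [mE : MeasurableSpace E] {P : Measure Ω}
  [IsFiniteMeasure P] {X : Ω → E} {Y Z : Ω → ℝ} {C : ℝ}

lemma integral_mul_comp_eq_integral_condExp_mul (hX : Measurable X) (hY : Integrable Y P)
    {H : E → ℝ} (hH : Measurable H) (hC : ∀ᵐ ω ∂P, |H (X ω)| ≤ C) :
    ∫ ω, Y ω * H (X ω) ∂P = ∫ ω, (P[Y | mE.comap X]) ω * H (X ω) ∂P := by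
  have hpull := condExp_mul_of_stronglyMeasurable_right
    (hH.comp (comap_measurable X)).stronglyMeasurable
    (hY.mul_bdd (hH.comp hX).aestronglyMeasurable hC) hY
  exact (integral_condExp hX.comap_le).symm.trans (integral_congr_ae hpull)

lemma integral_prod_mul_kernel_eq_condExp (hX : Measurable X) (hY : Integrable Y P)
    (hZm : Measurable Z) (hZ : Integrable Z P) {K : E × E → ℝ} (hK : Measurable K)
    (hC : ∀ᵐ w ∂P.prod P, |K (X w.1, X w.2)| ≤ C) :
    ∫ w, Y w.1 * Z w.2 * K (X w.1, X w.2) ∂P.prod P =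
      ∫ w, (P[Y | mE.comap X]) w.1 * Z w.2 * K (X w.1, X w.2) ∂P.prod P := by
  let H (x : E) : ℝ := ∫ ω', Z ω' * K (x, X ω') ∂P
  have hH : Measurable H := (StronglyMeasurable.integral_prod_right'
    (f := fun x : E × Ω => Z x.2 * K (x.1, X x.2)) (by fun_prop)).measurable
  have hHC : ∀ᵐ ω ∂P, |H (X ω)| ≤ ∫ ω', ‖Z ω'‖ * C ∂P := by
    filter_upwards [Measure.ae_ae_of_ae_prod hC] with ω hω
    exact norm_integral_le_of_norm_le (f := fun ω' => Z ω' * K (X ω, X ω')) (hZ.norm.mul_const C)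
      (hω.mono fun ω' h => (norm_mul_le _ _).trans (mul_le_mul_of_nonneg_left h (norm_nonneg _)))
  have hfubini {Y' : Ω → ℝ} (hY' : Integrable Y' P) :
      ∫ w, Y' w.1 * Z w.2 * K (X w.1, X w.2) ∂P.prod P = ∫ ω, Y' ω * H (X ω) ∂P := by
    have hint : Integrable (fun w : Ω × Ω => Y' w.1 * Z w.2 * K (X w.1, X w.2)) (P.prod P) :=
      (hY'.mul_prod hZ).mul_bdd (c := C)
        (Measurable.aestronglyMeasurable (by fun_prop)) hC
    rw [integral_prod _ hint]
    simp only [mul_assoc, integral_const_mul, H]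
  rw [hfubini hY, hfubini integrable_condExp,
    integral_mul_comp_eq_integral_condExp_mul hX hY hH hHC]

lemma pairForm_condExp_comap (hX : Measurable X) (hYm : Measurable Y) (hY : Integrable Y P)
    {K : E × E → ℝ} (hK : Measurable K) (hC : ∀ᵐ w ∂P.prod P, |K (X w.1, X w.2)| ≤ C) :
    pairForm P (P[Y | mE.comap X]) (fun ω ω' => K (X ω, X ω')) =
      pairForm P Y fun ω ω' => K (X ω, X ω') := by
  have hcondm : Measurable (P[Y | mE.comap X]) :=
    (stronglyMeasurable_condExp.mono hX.comap_le).measurable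
  have hswap {Y' Z' : Ω → ℝ} : ∫ w, Y' w.1 * Z' w.2 * K (X w.1, X w.2) ∂P.prod P =
      ∫ w, Z' w.1 * Y' w.2 * (K ∘ Prod.swap) (X w.1, X w.2) ∂P.prod P := by
    rw [← integral_prod_swap]
    simp only [Prod.fst_swap, Prod.snd_swap, Function.comp_apply, Prod.swap_prod_mk, mul_comm]
  rw [pairForm, ← integral_prod_mul_kernel_eq_condExp hX hY hcondm integrable_condExp hK hC, hswap,
    ← integral_prod_mul_kernel_eq_condExp hX hY hYm hY (hK.comp measurable_swap)
      (Measure.measurePreserving_swap.quasiMeasurePreserving.ae hC), ← hswap, pairForm]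

lemma pairForm_congr_of_condExp_comap_ae_eq (hX : Measurable X) (hYm : Measurable Y)
    (hY : Integrable Y P) (hYZ : P[Y | mE.comap X] =ᵐ[P] Z) {K : E × E → ℝ} (hK : Measurable K)
    (hC : ∀ᵐ w ∂P.prod P, |K (X w.1, X w.2)| ≤ C) :
    pairForm P Y (fun ω ω' => K (X ω, X ω')) = pairForm P Z fun ω ω' => K (X ω, X ω') := by
  rw [← pairForm_condExp_comap hX hYm hY hK hC]
  refine integral_congr_ae ?_
  filter_upwards [Measure.quasiMeasurePreserving_fst.ae hYZ,
    Measure.quasiMeasurePreserving_snd.ae hYZ] with w h h'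
  rw [h, h']

end Regression

section Decoupling

variable {Ω α₁ α₂ : Type*} [MeasurableSpace Ω] [mα₁ : MeasurableSpace α₁] [MeasurableSpace α₂]
  {P : Measure Ω} [IsProbabilityMeasure P] {W₁ : Ω → α₁} {W₂ : Ω → α₂} {G₁ : α₁ × α₁ → ℝ}
  {G₂ : α₂ × α₂ → ℝ} {B₁ B₂ : ℝ}

lemma abs_integral_le_of_ae_abs_le {f : Ω → ℝ} {C : ℝ} (hf : ∀ᵐ ω ∂P, |f ω| ≤ C) :
    |∫ ω, f ω ∂P| ≤ C := by
  simpa using norm_integral_le_of_norm_le_const (f := f) hf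

lemma abs_integral_prod_mul_sub_le_maximalCorrelation (hW₁ : Measurable W₁) (hW₂ : Measurable W₂)
    (hG₁ : Measurable G₁) (hG₂ : Measurable G₂)
    (hB₁ : ∀ᵐ w ∂P.prod P, |G₁ (W₁ w.1, W₁ w.2)| ≤ B₁)
    (hB₂ : ∀ᵐ w ∂P.prod P, |G₂ (W₂ w.1, W₂ w.2)| ≤ B₂) :
    |∫ w, G₁ (W₁ w.1, W₁ w.2) * G₂ (W₂ w.1, W₂ w.2) ∂P.prod P -
        (∫ w, G₁ (W₁ w.1, W₁ w.2) ∂P.prod P) * ∫ w, G₂ (W₂ w.1, W₂ w.2) ∂P.prod P| ≤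
      2 * (maximalCorrelation P W₁ W₂ * (B₁ * B₂)) := by
  let k₁ (x : α₁) : ℝ := ∫ ω', G₁ (x, W₁ ω') ∂P
  let k₂ (x : α₂) : ℝ := ∫ ω', G₂ (x, W₂ ω') ∂P
  have hk₁ : Measurable k₁ := (StronglyMeasurable.integral_prod_right'
    (f := fun x : α₁ × Ω => G₁ (x.1, W₁ x.2)) (by fun_prop)).measurable
  have hk₂ : Measurable k₂ := (StronglyMeasurable.integral_prod_right'
    (f := fun x : α₂ × Ω => G₂ (x.1, W₂ x.2)) (by fun_prop)).measurable
  have hi₁ : Integrable (fun w : Ω × Ω => G₁ (W₁ w.1, W₁ w.2)) (P.prod P) :=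
    .of_bound (Measurable.aestronglyMeasurable (by fun_prop)) B₁ hB₁
  have hi₂ : Integrable (fun w : Ω × Ω => G₂ (W₂ w.1, W₂ w.2)) (P.prod P) :=
    .of_bound (Measurable.aestronglyMeasurable (by fun_prop)) B₂ hB₂
  have hi : Integrable (fun w : Ω × Ω => G₁ (W₁ w.1, W₁ w.2) * G₂ (W₂ w.1, W₂ w.2)) (P.prod P) :=
    hi₁.mul_bdd hi₂.aestronglyMeasurable hB₂
  have hb₁ : ∀ᵐ ω ∂P, |k₁ (W₁ ω)| ≤ B₁ := (Measure.ae_ae_of_ae_prod hB₁).mono fun ω =>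
    abs_integral_le_of_ae_abs_le
  have hb₂ : ∀ᵐ ω ∂P, |k₂ (W₂ ω)| ≤ B₂ := (Measure.ae_ae_of_ae_prod hB₂).mono fun ω =>
    abs_integral_le_of_ae_abs_le
  have hik : Integrable (fun ω => k₁ (W₁ ω) * k₂ (W₂ ω)) P :=
    hi₁.integral_prod_left.mul_bdd (hk₂.comp hW₂).aestronglyMeasurable hb₂
  have hinner : ∀ᵐ ω ∂P, |∫ ω', G₁ (W₁ ω, W₁ ω') * G₂ (W₂ ω, W₂ ω') ∂P -
      k₁ (W₁ ω) * k₂ (W₂ ω)| ≤ maximalCorrelation P W₁ W₂ * (B₁ * B₂) := by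
    filter_upwards [Measure.ae_ae_of_ae_prod hB₁, Measure.ae_ae_of_ae_prod hB₂] with ω h₁ h₂
    exact abs_integral_mul_sub_le_maximalCorrelation hW₁ hW₂ (g₁ := fun x => G₁ (W₁ ω, x))
      (g₂ := fun x => G₂ (W₂ ω, x)) (by fun_prop) (by fun_prop) h₁ h₂
  have hmiddle := abs_integral_le_of_ae_abs_le hinner
  have houter := abs_integral_mul_sub_le_maximalCorrelation hW₁ hW₂ hk₁ hk₂ hb₁ hb₂
  rw [integral_sub hi.integral_prod_left hik, ← integral_prod _ hi] at hmiddle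
  rw [integral_prod _ hi₁, integral_prod _ hi₂, two_mul]
  exact (abs_sub_le _ _ _).trans (add_le_add hmiddle houter)

lemma abs_pairForm_mul_sub_le_maximalCorrelation {E : Type*} [mE : MeasurableSpace E]
    {X : Ω → E} {w₁ : E → α₁} {w₂ : E → α₂} {Y : Ω → ℝ} {B : ℝ} (hX : Measurable X)
    (hw₁ : Measurable w₁) (hw₂ : Measurable w₂) (hY : Measurable Y) (hB : ∀ᵐ ω ∂P, |Y ω| ≤ B)
    (hXY : P[Y | mE.comap X] =ᵐ[P] P[Y | mα₁.comap (w₁ ∘ X)])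
    (hG₁ : Measurable G₁) (hG₂ : Measurable G₂)
    (hB₁ : ∀ᵐ w ∂P.prod P, |G₁ (w₁ (X w.1), w₁ (X w.2))| ≤ B₁)
    (hB₂ : ∀ᵐ w ∂P.prod P, |G₂ (w₂ (X w.1), w₂ (X w.2))| ≤ B₂) :
    |pairForm P Y (fun ω ω' => G₁ (w₁ (X ω), w₁ (X ω')) * G₂ (w₂ (X ω), w₂ (X ω'))) -
        pairForm P Y (fun ω ω' => G₁ (w₁ (X ω), w₁ (X ω'))) *
          ∫ w, G₂ (w₂ (X w.1), w₂ (X w.2)) ∂P.prod P| ≤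
      2 * (maximalCorrelation P (w₁ ∘ X) (w₂ ∘ X) * (B ^ 2 * B₁ * B₂)) := by
  have hYi : Integrable Y P := .of_bound hY.aestronglyMeasurable B hB
  obtain ⟨f, hf, hYf⟩ := (stronglyMeasurable_condExp (μ := P) (f := Y)
    (m := mα₁.comap (w₁ ∘ X))).measurable.exists_eq_measurable_comp
  rw [hYf] at hXY
  have hfB : ∀ᵐ ω ∂P, |f (w₁ (X ω))| ≤ B := by
    filter_upwards [hXY, ae_bdd_abs_condExp_of_ae_bdd_abs (m := mE.comap X) hB] with ω hω hle
    rwa [hω] at hle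
  have hfG₁ : ∀ᵐ w ∂P.prod P,
      |f (w₁ (X w.1)) * f (w₁ (X w.2)) * G₁ (w₁ (X w.1), w₁ (X w.2))| ≤ B ^ 2 * B₁ := by
    filter_upwards [Measure.quasiMeasurePreserving_fst.ae hfB,
      Measure.quasiMeasurePreserving_snd.ae hfB, hB₁] with w h h' h₁
    have hB0 := (abs_nonneg _).trans h
    rw [abs_mul, abs_mul, pow_two]
    gcongr
  have hprod : ∀ᵐ w ∂P.prod P,
      |G₁ (w₁ (X w.1), w₁ (X w.2)) * G₂ (w₂ (X w.1), w₂ (X w.2))| ≤ B₁ * B₂ := by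
    filter_upwards [hB₁, hB₂] with w h₁ h₂
    rw [abs_mul]
    exact mul_le_mul h₁ h₂ (abs_nonneg _) ((abs_nonneg _).trans h₁)
  rw [pairForm_congr_of_condExp_comap_ae_eq hX hY hYi hXY
      (K := fun x => G₁ (w₁ x.1, w₁ x.2) * G₂ (w₂ x.1, w₂ x.2)) (by fun_prop) hprod,
    pairForm_congr_of_condExp_comap_ae_eq hX hY hYi hXY
      (K := fun x => G₁ (w₁ x.1, w₁ x.2)) (by fun_prop) hB₁]
  simpa only [pairForm, Function.comp_apply, ← mul_assoc] using
    abs_integral_prod_mul_sub_le_maximalCorrelation (hw₁.comp hX) (hw₂.comp hX)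
      (G₁ := fun x => f x.1 * f x.2 * G₁ x) (by fun_prop) hG₂ hfG₁ hB₂

end Decoupling

/-! ### Quadratic forms of exponential kernels -/

section BoundedFeatures

variable {Ω : Type*} [MeasurableSpace Ω] {P : Measure Ω}

lemma ae_prod_abs_sub_pow_le {ι : Type*} [SFinite P] {X : Ω → ι → ℝ} {R : ℝ} (q : ℕ)
    (hR : ∀ᵐ ω ∂P, ∀ i, |X ω i| ≤ R) :
    ∀ᵐ w ∂P.prod P, ∀ i, |X w.1 i - X w.2 i| ^ q ≤ (2 * R) ^ q := by
  filter_upwards [Measure.quasiMeasurePreserving_fst.ae hR,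
    Measure.quasiMeasurePreserving_snd.ae hR] with w h h' i
  gcongr
  linarith [abs_sub (X w.1 i) (X w.2 i), h i, h' i]

lemma integrable_abs_sub_pow [IsFiniteMeasure P] {f : Ω → ℝ} (hf : Measurable f) {q : ℕ} {D : ℝ}
    (hD : ∀ᵐ w ∂P.prod P, |f w.1 - f w.2| ^ q ≤ D) :
    Integrable (fun w : Ω × Ω => |f w.1 - f w.2| ^ q) (P.prod P) :=
  .of_bound (by fun_prop) D (hD.mono fun w hw => by
    simpa only [norm_pow, Real.norm_eq_abs, abs_abs] using hw)

lemma integral_prod_sub_sq [IsProbabilityMeasure P] {f : Ω → ℝ} (hf : MemLp f 2 P) :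
    ∫ w, (f w.1 - f w.2) ^ 2 ∂P.prod P = 2 * variance f P := by
  have hsq := hf.integrable_sq
  have hf1 := hf.integrable one_le_two
  have hexpand (w : Ω × Ω) :
      (f w.1 - f w.2) ^ 2 = f w.1 ^ 2 + f w.2 ^ 2 - 2 * (f w.1 * f w.2) := by ring
  simp only [hexpand]
  rw [integral_sub (f := fun w : Ω × Ω => f w.1 ^ 2 + f w.2 ^ 2)
      ((hsq.comp_fst P).add (hsq.comp_snd P)) ((hf1.mul_prod hf1).const_mul 2),
    integral_add (hsq.comp_fst P) (hsq.comp_snd P), integral_const_mul, integral_prod_mul,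
    integral_fun_fst (fun ω => f ω ^ 2), integral_fun_snd (fun ω => f ω ^ 2), variance_eq_sub hf]
  simp only [probReal_univ, one_smul, Pi.pow_apply]
  ring

lemma variance_le_mul_integral_abs_sub_pow [IsProbabilityMeasure P] {f : Ω → ℝ} {R : ℝ} {q : ℕ}
    (hq : q = 1 ∨ q = 2) (hf : Measurable f) (hR : ∀ᵐ ω ∂P, |f ω| ≤ R) :
    variance f P ≤ (1 + (2 * R) ^ q) * ∫ w, |f w.1 - f w.2| ^ q ∂P.prod P := by
  have hR0 : 0 ≤ R := nonneg_of_ae_abs_le hR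
  have hle := (ae_prod_abs_sub_pow_le (X := fun ω (_ : Unit) => f ω) q
    (hR.mono fun ω h _ => h)).mono fun w h => h ()
  have hLp : MemLp f 2 P := .of_bound hf.aestronglyMeasurable R hR
  have hsq : ∫ w, (f w.1 - f w.2) ^ 2 ∂P.prod P ≤
      ∫ w, (1 + (2 * R) ^ q) * |f w.1 - f w.2| ^ q ∂P.prod P := by
    refine integral_mono_of_nonneg (ae_of_all _ fun w => sq_nonneg _)
      ((integrable_abs_sub_pow hf hle).const_mul _) (hle.mono fun w hw => ?_)
    rcases hq with rfl | rfl <;> simp only [pow_one, ← sq_abs (f w.1 - f w.2)] at hw ⊢ <;>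
      nlinarith [abs_nonneg (f w.1 - f w.2), hR0]
  rw [integral_prod_sub_sq hLp, integral_const_mul] at hsq
  linarith [variance_nonneg f P]

end BoundedFeatures

section FeatureSelection

variable {Ω ι : Type*} [MeasurableSpace Ω] [Fintype ι] [DecidableEq ι] {P : Measure Ω}
  {X : Ω → ι → ℝ} {Y : Ω → ℝ} {S : Finset ι} {q : ℕ} {b : ι → ℝ} {B R : ℝ}

lemma expKernel_sub_eq_mul_compl (q : ℕ) (b s s' : ι → ℝ) (S : Finset ι) :
    expKernel q b (s - s') = expKernel q (S.restrict b) (S.restrict s - S.restrict s') *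
      expKernel q (Sᶜ.restrict b) (Sᶜ.restrict s - Sᶜ.restrict s') := by
  simp only [expKernel, ← Real.exp_add, ← neg_add, Pi.sub_apply, Finset.restrict]
  rw [Finset.sum_coe_sort S fun i => b i * |s i - s' i| ^ q,
    Finset.sum_coe_sort Sᶜ fun i => b i * |s i - s' i| ^ q, Finset.sum_add_sum_compl]

omit [Fintype ι] [DecidableEq ι] in
lemma restrict_nonneg (hb : ∀ i, 0 ≤ b i) (S : Finset ι) (i : S) : 0 ≤ S.restrict b i := hb i

lemma expKernel_sub_le_restrict_compl (hb : ∀ i, 0 ≤ b i) (s s' : ι → ℝ) :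
    expKernel q b (s - s') ≤ expKernel q (Sᶜ.restrict b) (Sᶜ.restrict s - Sᶜ.restrict s') := by
  rw [expKernel_sub_eq_mul_compl q b s s' S]
  exact mul_le_of_le_one_left (Real.exp_pos _).le (expKernel_le_one (restrict_nonneg hb S) _)

omit [DecidableEq ι] in
lemma exp_neg_card_mul_le_expKernel {s : ι → ℝ} {c D : ℝ} (hb : ∀ i, 0 ≤ b i)
    (hc : ∀ i, b i ≤ c) (hD : ∀ i, |s i| ^ q ≤ D) :
    Real.exp (-(Fintype.card ι * (c * D))) ≤ expKernel q b s := by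
  refine Real.exp_le_exp.2 (neg_le_neg ?_)
  calc ∑ i, b i * |s i| ^ q ≤ ∑ _i : ι, c * D := by
        gcongr with i
        exacts [(hb i).trans (hc i), hc i, hD i]
    _ = Fintype.card ι * (c * D) := by simp

/-- A lower bound for `E [|X l - X' l| ^ q * exp (-∑ i, b i * |X i - X' i| ^ q)]` when the `N`
features are bounded by `R`, the variance of `X l` is at least `v` and the weights `b i` are at
most `c`. -/
def weightBound (N q : ℕ) (R v c : ℝ) : ℝ :=
  Real.exp (-(N * (c * (2 * R) ^ q))) * (v / (1 + (2 * R) ^ q))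

lemma weightBound_pos {N q : ℕ} {R v c : ℝ} (hR : 0 ≤ R) (hv : 0 < v) :
    0 < weightBound N q R v c := by
  unfold weightBound
  positivity

lemma weightBound_le_integral [IsProbabilityMeasure P] (hq : q = 1 ∨ q = 2) (hX : Measurable X)
    (hR : ∀ᵐ ω ∂P, ∀ i, |X ω i| ≤ R) {l : ι} {v c : ℝ} (hv : v ≤ variance (fun ω => X ω l) P)
    (hb : ∀ i, 0 ≤ b i) (hc : ∀ i, b i ≤ c) :
    weightBound (Fintype.card ι) q R v c ≤ ∫ w, |X w.1 l - X w.2 l| ^ q *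
      expKernel q (Sᶜ.restrict b) (Sᶜ.restrict (X w.1) - Sᶜ.restrict (X w.2)) ∂P.prod P := by
  have hXl : Measurable fun ω => X ω l := by fun_prop
  have hRl := hR.mono fun ω h => h l
  have hR0 : 0 ≤ R := nonneg_of_ae_abs_le hRl
  have hle := ae_prod_abs_sub_pow_le q hR
  have hint := integrable_abs_sub_pow hXl (hle.mono fun w h => h l)
  have hkernel : Integrable (fun w : Ω × Ω => |X w.1 l - X w.2 l| ^ q *
      expKernel q (Sᶜ.restrict b) (Sᶜ.restrict (X w.1) - Sᶜ.restrict (X w.2))) (P.prod P) :=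
    hint.mul_bdd (c := 1) ((measurable_expKernel q _).comp (by fun_prop)).aestronglyMeasurable
      (ae_of_all _ fun w => abs_expKernel_le_one (restrict_nonneg hb _) _)
  calc weightBound (Fintype.card ι) q R v c
      ≤ Real.exp (-(Fintype.card ι * (c * (2 * R) ^ q))) *
          ∫ w, |X w.1 l - X w.2 l| ^ q ∂P.prod P := by
        refine mul_le_mul_of_nonneg_left ?_ (Real.exp_pos _).le
        rw [div_le_iff₀' (by positivity)]
        exact hv.trans (variance_le_mul_integral_abs_sub_pow hq hXl hRl)
    _ ≤ _ := by
        rw [← integral_const_mul]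
        refine integral_mono_ae (hint.const_mul _) hkernel (hle.mono fun w hw => ?_)
        simp only [mul_comm (|X w.1 l - X w.2 l| ^ q)]
        gcongr
        exact (exp_neg_card_mul_le_expKernel hb hc hw).trans
          (expKernel_sub_le_restrict_compl hb _ _)

/-- The coordinates of `X` in `S` are sufficient for predicting `Y`: `E [Y | X] = E [Y | X_S]`
almost surely. This is `FullPredictivePower` for random variables on an arbitrary probability
space. -/
def IsSufficient (P : Measure Ω) (X : Ω → ι → ℝ) (Y : Ω → ℝ) (S : Finset ι) : Prop :=
  P[Y | MeasurableSpace.comap X inferInstance] =ᵐ[P]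
    P[Y | MeasurableSpace.comap (S.restrict ∘ X) inferInstance]

omit [Fintype ι] [DecidableEq ι] in
lemma pairForm_expKernel_restrict_nonneg [SFinite P] (hq : q = 1 ∨ q = 2) (hX : Measurable X)
    (hY : Integrable Y P) (hb : ∀ i, 0 ≤ b i) (S : Finset ι) :
    0 ≤ pairForm P Y fun ω ω' =>
      expKernel q (S.restrict b) (S.restrict (X ω) - S.restrict (X ω')) :=
  pairForm_expKernel_nonneg hq ((Finset.measurable_restrict S).comp hX) hY (restrict_nonneg hb S)

variable [IsProbabilityMeasure P]

lemma abs_pairForm_expKernel_restrict_mul_sub_le (hX : Measurable X) (hY : Measurable Y)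
    (hB : ∀ᵐ ω ∂P, |Y ω| ≤ B) (hS : IsSufficient P X Y S) (hb : ∀ i, 0 ≤ b i)
    {G : (↥Sᶜ → ℝ) × (↥Sᶜ → ℝ) → ℝ} (hG : Measurable G) {D : ℝ}
    (hD : ∀ᵐ w ∂P.prod P, |G (Sᶜ.restrict (X w.1), Sᶜ.restrict (X w.2))| ≤ D) :
    |pairForm P Y (fun ω ω' => expKernel q (S.restrict b) (S.restrict (X ω) - S.restrict (X ω')) *
          G (Sᶜ.restrict (X ω), Sᶜ.restrict (X ω'))) -
        pairForm P Y (fun ω ω' =>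
          expKernel q (S.restrict b) (S.restrict (X ω) - S.restrict (X ω'))) *
          ∫ w, G (Sᶜ.restrict (X w.1), Sᶜ.restrict (X w.2)) ∂P.prod P| ≤
      2 * (maximalCorrelation P (S.restrict ∘ X) (Sᶜ.restrict ∘ X) * (B ^ 2 * D)) := by
  simpa only [mul_one] using abs_pairForm_mul_sub_le_maximalCorrelation hX
    (Finset.measurable_restrict S) (Finset.measurable_restrict Sᶜ) hY hB hS
    (G₁ := fun x => expKernel q (S.restrict b) (x.1 - x.2))
    ((measurable_expKernel q _).comp (by fun_prop)) hG
    (ae_of_all _ fun w => abs_expKernel_le_one (restrict_nonneg hb S) _) hD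

lemma pairForm_expKernel_le_restrict_add (hq : q = 1 ∨ q = 2) (hX : Measurable X)
    (hY : Measurable Y) (hB : ∀ᵐ ω ∂P, |Y ω| ≤ B) (hS : IsSufficient P X Y S)
    (hb : ∀ i, 0 ≤ b i) :
    pairForm P Y (fun ω ω' => expKernel q b (X ω - X ω')) ≤
      pairForm P Y (fun ω ω' =>
          expKernel q (S.restrict b) (S.restrict (X ω) - S.restrict (X ω'))) +
        2 * (maximalCorrelation P (S.restrict ∘ X) (Sᶜ.restrict ∘ X) * B ^ 2) := by
  have hkernel (w : Ω × Ω) :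
      |expKernel q (Sᶜ.restrict b) (Sᶜ.restrict (X w.1) - Sᶜ.restrict (X w.2))| ≤ 1 :=
    abs_expKernel_le_one (restrict_nonneg hb _) _
  have hdecouple := abs_pairForm_expKernel_restrict_mul_sub_le (q := q) hX hY hB hS hb
    (G := fun x => expKernel q (Sᶜ.restrict b) (x.1 - x.2))
    ((measurable_expKernel q _).comp (by fun_prop)) (ae_of_all _ hkernel)
  have hmean := (le_abs_self _).trans
    (abs_integral_le_of_ae_abs_le (P := P.prod P) (ae_of_all _ hkernel))
  have hprod := mul_le_of_le_one_right (pairForm_expKernel_restrict_nonneg hq hX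
    (.of_bound hY.aestronglyMeasurable B hB) hb S) hmean
  simp only [expKernel_sub_eq_mul_compl q b _ _ S]
  linarith [(abs_le.1 hdecouple).2]

lemma mul_pairForm_expKernel_restrict_sub_le (hq : q = 1 ∨ q = 2) (hX : Measurable X)
    (hY : Measurable Y) (hB : ∀ᵐ ω ∂P, |Y ω| ≤ B) (hS : IsSufficient P X Y S)
    (hb : ∀ i, 0 ≤ b i) {l : ι} (hl : l ∉ S) {D w₀ : ℝ}
    (hD : ∀ᵐ w ∂P.prod P, |X w.1 l - X w.2 l| ^ q ≤ D)
    (hw₀ : w₀ ≤ ∫ w, |X w.1 l - X w.2 l| ^ q *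
      expKernel q (Sᶜ.restrict b) (Sᶜ.restrict (X w.1) - Sᶜ.restrict (X w.2)) ∂P.prod P) :
    w₀ * pairForm P Y (fun ω ω' =>
          expKernel q (S.restrict b) (S.restrict (X ω) - S.restrict (X ω'))) -
        2 * (maximalCorrelation P (S.restrict ∘ X) (Sᶜ.restrict ∘ X) * (B ^ 2 * D)) ≤
      pairForm P Y fun ω ω' => |X ω l - X ω' l| ^ q * expKernel q b (X ω - X ω') := by
  let l' : ↥Sᶜ := ⟨l, Finset.mem_compl.2 hl⟩
  have hdecouple := abs_pairForm_expKernel_restrict_mul_sub_le (q := q) (D := D) hX hY hB hS hb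
    (G := fun x => |x.1 l' - x.2 l'| ^ q * expKernel q (Sᶜ.restrict b) (x.1 - x.2))
    (.mul (by fun_prop) ((measurable_expKernel q _).comp (by fun_prop)))
    (hD.mono fun w hw => by
      rw [abs_mul, abs_pow, abs_abs]
      exact (mul_le_of_le_one_right (by positivity)
        (abs_expKernel_le_one (restrict_nonneg hb _) _)).trans hw)
  have hprod := mul_le_mul_of_nonneg_left hw₀ (pairForm_expKernel_restrict_nonneg hq hX
    (.of_bound hY.aestronglyMeasurable B hB) hb S)
  simp only [expKernel_sub_eq_mul_compl q b _ _ S, mul_left_comm (|X _ l - X _ l| ^ q)]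
  simp only [l', Finset.restrict_def] at hdecouple hprod ⊢
  linarith [(abs_le.1 hdecouple).1]

lemma mul_pairForm_expKernel_sub_le (hq : q = 1 ∨ q = 2) (hX : Measurable X) (hY : Measurable Y)
    (hR : ∀ᵐ ω ∂P, ∀ i, |X ω i| ≤ R) (hB : ∀ᵐ ω ∂P, |Y ω| ≤ B) (hS : IsSufficient P X Y S)
    {l : ι} (hl : l ∉ S) {v c : ℝ} (hv0 : 0 < v) (hv : v ≤ variance (fun ω => X ω l) P)
    (hb : ∀ i, 0 ≤ b i) (hc : ∀ i, b i ≤ c) :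
    weightBound (Fintype.card ι) q R v c *
        pairForm P Y (fun ω ω' => expKernel q b (X ω - X ω')) -
        maximalCorrelation P (S.restrict ∘ X) (Sᶜ.restrict ∘ X) *
          (2 * B ^ 2 * (weightBound (Fintype.card ι) q R v c + (2 * R) ^ q)) ≤
      pairForm P Y fun ω ω' => |X ω l - X ω' l| ^ q * expKernel q b (X ω - X ω') := by
  have hR0 : 0 ≤ R := nonneg_of_ae_abs_le (hR.mono fun ω h => h l)
  have hvalue := mul_le_mul_of_nonneg_left
    (pairForm_expKernel_le_restrict_add hq hX hY hB hS hb)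
    (weightBound_pos (N := Fintype.card ι) (q := q) (c := c) hR0 hv0).le
  have hslope := mul_pairForm_expKernel_restrict_sub_le hq hX hY hB hS hb hl
    ((ae_prod_abs_sub_pow_le q hR).mono fun w h => h l)
    (weightBound_le_integral hq hX hR hv hb hc)
  linarith

end FeatureSelection

section Mixture

variable {Ω : Type*} [MeasurableSpace Ω] {P : Measure Ω} {Y : Ω → ℝ}
  {μ : Measure ℝ} [IsFiniteMeasure μ] {K : ℝ → Ω → Ω → ℝ} {C : ℝ}

lemma pairForm_const_mul (P : Measure Ω) (Y : Ω → ℝ) (c : ℝ) (k : Ω → Ω → ℝ) :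
    pairForm P Y (fun ω ω' => c * k ω ω') = c * pairForm P Y k := by
  simp only [pairForm, mul_left_comm _ c, integral_const_mul]

lemma integrable_pair_mul_mixture (hY : Integrable Y P)
    (hK : Measurable fun x : (Ω × Ω) × ℝ => K x.2 x.1.1 x.1.2)
    (hC : ∀ᵐ x ∂(P.prod P).prod μ, |K x.2 x.1.1 x.1.2| ≤ C) :
    Integrable (fun x : (Ω × Ω) × ℝ => Y x.1.1 * Y x.1.2 * K x.2 x.1.1 x.1.2)
      ((P.prod P).prod μ) :=
  ((hY.mul_prod hY).comp_fst μ).mul_bdd hK.aestronglyMeasurable hC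

variable [SFinite P]

lemma integrable_pairForm_mixture (hY : Integrable Y P)
    (hK : Measurable fun x : (Ω × Ω) × ℝ => K x.2 x.1.1 x.1.2)
    (hC : ∀ᵐ x ∂(P.prod P).prod μ, |K x.2 x.1.1 x.1.2| ≤ C) :
    Integrable (fun t => pairForm P Y (K t)) μ :=
  (integrable_pair_mul_mixture hY hK hC).integral_prod_right

lemma pairForm_integral_mixture (hY : Integrable Y P)
    (hK : Measurable fun x : (Ω × Ω) × ℝ => K x.2 x.1.1 x.1.2)
    (hC : ∀ᵐ x ∂(P.prod P).prod μ, |K x.2 x.1.1 x.1.2| ≤ C) :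
    pairForm P Y (fun ω ω' => ∫ t, K t ω ω' ∂μ) = ∫ t, pairForm P Y (K t) ∂μ := by
  simp only [pairForm, ← integral_const_mul]
  exact integral_integral_swap (f := fun (w : Ω × Ω) t => Y w.1 * Y w.2 * K t w.1 w.2)
    (integrable_pair_mul_mixture hY hK hC)

end Mixture

/-! ### The population objective -/

section ScaleMixture

variable {q : ℕ} {μ : Measure ℝ} {Q : Measure (Obs p)} {β : EuclideanSpace ℝ (Fin p)}

lemma exp_neg_mul_weightedNormPow_sub (t : ℝ) (x x' : Fin p → ℝ) :
    Real.exp (-(t * weightedNormPow q β fun i => x i - x' i)) =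
      expKernel q (fun i => t * β i) (x - x') := by
  simp only [weightedNormPow, expKernel, Finset.mul_sum, mul_assoc, Pi.sub_apply]

/-- The value `E [Y Y' exp (-t ∑ i, β i * |X i - X' i| ^ q)]` of `-objective` at the single scale
`t` of the mixture defining `kernelFun`. -/
def scaleValue (q : ℕ) (Q : Measure (Obs p)) (β : EuclideanSpace ℝ (Fin p)) (t : ℝ) : ℝ :=
  pairForm Q Prod.snd fun z z' => expKernel q (fun i => t * β i) (z.1 - z'.1)

/-- The contribution of the single scale `t` to `objectiveSlope`, divided by `t`. -/
def scaleSlope (q : ℕ) (Q : Measure (Obs p)) (l : Fin p) (β : EuclideanSpace ℝ (Fin p))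
    (t : ℝ) : ℝ :=
  pairForm Q Prod.snd fun z z' =>
    |z.1 l - z'.1 l| ^ q * expKernel q (fun i => t * β i) (z.1 - z'.1)

lemma measurable_expKernel_scale (q : ℕ) (β : EuclideanSpace ℝ (Fin p)) :
    Measurable fun x : (Obs p × Obs p) × ℝ =>
      expKernel q (fun i => x.2 * β i) (x.1.1.1 - x.1.2.1) :=
  ((continuous_expKernel q).comp (by fun_prop : Continuous fun x : (Obs p × Obs p) × ℝ =>
    ((fun i => x.2 * β i : Fin p → ℝ), x.1.1.1 - x.1.2.1))).measurable

lemma ae_abs_expKernel_scale_le_one (hμ : ∀ᵐ t ∂μ, 0 ≤ t) (hβ : ∀ i, 0 ≤ β i) :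
    ∀ᵐ x ∂(Q.prod Q).prod μ,
      |expKernel q (fun i => x.2 * β i) (x.1.1.1 - x.1.2.1)| ≤ 1 := by
  filter_upwards [Measure.quasiMeasurePreserving_snd.ae hμ] with x hx
  exact abs_expKernel_le_one (fun i => mul_nonneg hx (hβ i)) _

variable [IsFiniteMeasure μ] [IsFiniteMeasure Q]

lemma integrable_scaleValue (hY : Integrable Prod.snd Q) (hμ : ∀ᵐ t ∂μ, 0 ≤ t)
    (hβ : ∀ i, 0 ≤ β i) : Integrable (scaleValue q Q β) μ :=
  integrable_pairForm_mixture hY (measurable_expKernel_scale q β)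
    (ae_abs_expKernel_scale_le_one hμ hβ)

lemma neg_objective_eq_integral_scaleValue (hY : Integrable Prod.snd Q) (hμ : ∀ᵐ t ∂μ, 0 ≤ t)
    (hβ : ∀ i, 0 ≤ β i) : -objective q μ Q β = ∫ t, scaleValue q Q β t ∂μ := by
  simp only [objective, neg_neg, kernelFun, exp_neg_mul_weightedNormPow_sub]
  exact pairForm_integral_mixture
    (K := fun t (z z' : Obs p) => expKernel q (fun i => t * β i) (z.1 - z'.1)) hY
    (measurable_expKernel_scale q β) (ae_abs_expKernel_scale_le_one hμ hβ)

omit [IsFiniteMeasure μ] in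
lemma ae_abs_slope_scale_le {R c : ℝ} (hR : ∀ᵐ z ∂Q, ∀ i, |z.1 i| ≤ R)
    (hμ : ∀ᵐ t ∂μ, t ∈ Icc 0 c) (hβ : ∀ i, 0 ≤ β i) (l : Fin p) :
    ∀ᵐ x ∂(Q.prod Q).prod μ, |x.2 * (|x.1.1.1 l - x.1.2.1 l| ^ q *
      expKernel q (fun i => x.2 * β i) (x.1.1.1 - x.1.2.1))| ≤ c * ((2 * R) ^ q * 1) := by
  filter_upwards [Measure.quasiMeasurePreserving_snd.ae hμ,
    Measure.quasiMeasurePreserving_fst.ae (ae_prod_abs_sub_pow_le q hR)] with x hx hle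
  have hkernel : |expKernel q (fun i => x.2 * β i) (x.1.1.1 - x.1.2.1)| ≤ 1 :=
    abs_expKernel_le_one (fun i => mul_nonneg hx.1 (hβ i)) _
  have hD : 0 ≤ (2 * R) ^ q := (pow_nonneg (abs_nonneg _) q).trans (hle l)
  rw [abs_mul, abs_mul, abs_of_nonneg hx.1, abs_pow, abs_abs]
  exact mul_le_mul hx.2 (mul_le_mul (hle l) hkernel (abs_nonneg _) hD) (by positivity)
    (hx.1.trans hx.2)

lemma integrable_mul_scaleSlope {R c : ℝ} (hR : ∀ᵐ z ∂Q, ∀ i, |z.1 i| ≤ R)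
    (hY : Integrable Prod.snd Q) (hμ : ∀ᵐ t ∂μ, t ∈ Icc 0 c) (hβ : ∀ i, 0 ≤ β i) (l : Fin p) :
    Integrable (fun t => t * scaleSlope q Q l β t) μ := by
  simp only [scaleSlope, ← pairForm_const_mul]
  have := measurable_expKernel_scale q β
  exact integrable_pairForm_mixture hY (by fun_prop) (ae_abs_slope_scale_le hR hμ hβ l)

lemma objectiveSlope_eq_integral_mul_scaleSlope {R c : ℝ} (hR : ∀ᵐ z ∂Q, ∀ i, |z.1 i| ≤ R)
    (hY : Integrable Prod.snd Q) (hμ : ∀ᵐ t ∂μ, t ∈ Icc 0 c) (hβ : ∀ i, 0 ≤ β i) (l : Fin p) :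
    objectiveSlope q μ Q l β = ∫ t, t * scaleSlope q Q l β t ∂μ := by
  have := measurable_expKernel_scale q β
  simp only [scaleSlope, ← pairForm_const_mul]
  rw [← pairForm_integral_mixture hY (by fun_prop) (ae_abs_slope_scale_le hR hμ hβ l)]
  simp only [objectiveSlope, slopeKernel, kernelSlope, exp_neg_mul_weightedNormPow_sub, pairForm,
    mul_left_comm _ (|_| ^ q), integral_const_mul]

lemma scaleValue_nonneg (hq : q = 1 ∨ q = 2) (hY : Integrable Prod.snd Q) (hβ : ∀ i, 0 ≤ β i)
    {t : ℝ} (ht : 0 ≤ t) : 0 ≤ scaleValue q Q β t :=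
  pairForm_expKernel_nonneg hq measurable_fst hY fun i => mul_nonneg ht (hβ i)

end ScaleMixture

section Population

variable {q : ℕ} {μ : Measure ℝ} {Q : Measure (Obs p)} {β : EuclideanSpace ℝ (Fin p)}
  {S : Finset (Fin p)} {MX MY v : ℝ}

lemma condExp_comap_subFeatures_empty [IsProbabilityMeasure Q] (hc : ∫ z, z.2 ∂Q = 0) :
    Q[fun z : Obs p => z.2 | MeasurableSpace.comap (subFeatures ∅) inferInstance] = 0 := by
  have hconst : subFeatures (∅ : Finset (Fin p)) = fun _ => 0 := Subsingleton.elim _ _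
  rw [hconst, MeasurableSpace.comap_const, condExp_bot, hc]
  rfl

lemma not_condExp_ae_eq_zero [IsProbabilityMeasure Q] (hc : ∫ z, z.2 ∂Q = 0)
    (hE : ¬ FullPredictivePower Q ∅) :
    ¬ Q[Prod.snd | MeasurableSpace.comap (Prod.fst : Obs p → Fin p → ℝ) inferInstance] =ᵐ[Q] 0 := by
  rwa [FullPredictivePower, condExp_comap_subFeatures_empty hc] at hE

lemma RegularPopulation.integrable_response (hQ : RegularPopulation Q MX MY v) :
    Integrable Prod.snd Q :=
  have := hQ.prob
  .of_bound (by fun_prop) MY hQ.bounded_response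

lemma RegularPopulation.mono (hQ : RegularPopulation Q MX MY v) {MX' MY' : ℝ} (hX : MX ≤ MX')
    (hY : MY ≤ MY') : RegularPopulation Q MX' MY' v where
  prob := hQ.prob
  centered := hQ.centered
  bounded_features := hQ.bounded_features.mono fun _ hz i => (hz i).trans hX
  bounded_response := hQ.bounded_response.mono fun _ hz => hz.trans hY
  variance_ge := hQ.variance_ge

lemma objective_neg_of_pos (hq : q = 1 ∨ q = 2) (hμ : KernelMeasure μ)
    [IsProbabilityMeasure Q] (hY : Integrable Prod.snd Q) (hc : ∫ z, z.2 ∂Q = 0)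
    (hE : ¬ FullPredictivePower Q ∅) (hβ : ∀ i, 0 < β i) : objective q μ Q β < 0 := by
  have := hμ.finite
  obtain ⟨a, b, ha, -, hae⟩ := hμ.exists_bounds
  have hpos : ∀ᵐ t ∂μ, 0 < scaleValue q Q β t := hae.mono fun t ht =>
    pairForm_expKernel_pos hq measurable_fst measurable_snd hY
      (fun i => mul_pos (ha.trans_le ht.1) (hβ i)) (not_condExp_ae_eq_zero hc hE)
  have hμ0 : ∀ᵐ t ∂μ, 0 ≤ t := hae.mono fun t ht => ha.le.trans ht.1
  rw [← neg_pos, neg_objective_eq_integral_scaleValue hY hμ0 fun i => (hβ i).le,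
    integral_pos_iff_support_of_nonneg_ae (hpos.mono fun t => le_of_lt)
      (integrable_scaleValue hY hμ0 fun i => (hβ i).le),
    measure_congr (show Function.support (scaleValue q Q β) =ᵐ[μ] univ from
      eventuallyEq_univ.2 (hpos.mono fun t => ne_of_gt))]
  exact Measure.measure_univ_pos.2 hμ.ne_zero

lemma weightBound_mul_scaleValue_sub_le (hq : q = 1 ∨ q = 2) (hQ : RegularPopulation Q MX MY v)
    (hv : 0 < v) (hS : FullPredictivePower Q S) {l : Fin p} (hl : l ∉ S) {M : ℝ}
    (hβ : β ∈ feasibleSet p M) {t b : ℝ} (ht : t ∈ Icc 0 b) :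
    weightBound p q MX v (b * M) * scaleValue q Q β t -
        maximalCorrelation Q (subFeatures S) (subFeatures Sᶜ) *
          (2 * MY ^ 2 * (weightBound p q MX v (b * M) + (2 * MX) ^ q)) ≤
      scaleSlope q Q l β t := by
  have := hQ.prob
  have h := mul_pairForm_expKernel_sub_le hq measurable_fst measurable_snd hQ.bounded_features
    hQ.bounded_response hS hl hv (hQ.variance_ge l) (fun i => mul_nonneg ht.1 (hβ i).1)
    (fun i => mul_le_mul ht.2 (hβ i).2 (hβ i).1 (ht.1.trans ht.2))
  rw [Fintype.card_fin] at h
  exact h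

lemma mul_scaleValue_sub_le_mul_scaleSlope (hq : q = 1 ∨ q = 2) (hQ : RegularPopulation Q MX MY v)
    (hv : 0 < v) (hS : FullPredictivePower Q S) {l : Fin p} (hl : l ∉ S) {M : ℝ}
    (hβ : β ∈ feasibleSet p M) {a b t : ℝ} (ha : 0 ≤ a) (ht : t ∈ Icc a b) :
    a * weightBound p q MX v (b * M) * scaleValue q Q β t -
        maximalCorrelation Q (subFeatures S) (subFeatures Sᶜ) *
          (b * (2 * MY ^ 2 * (weightBound p q MX v (b * M) + (2 * MX) ^ q))) ≤
      t * scaleSlope q Q l β t := by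
  have := hQ.prob
  have hMX : 0 ≤ MX := nonneg_of_ae_abs_le (hQ.bounded_features.mono fun z h => h l)
  have hθ := maximalCorrelation_nonneg Q (subFeatures S) (subFeatures Sᶜ)
  set θ := maximalCorrelation Q (subFeatures S) (subFeatures Sᶜ)
  have hw₀ : 0 < weightBound p q MX v (b * M) := weightBound_pos hMX hv
  have ht0 : 0 ≤ t := ha.trans ht.1
  have hslope := mul_le_mul_of_nonneg_left
    (weightBound_mul_scaleValue_sub_le hq hQ hv hS hl hβ ⟨ht0, ht.2⟩) ht0
  set w₀ := weightBound p q MX v (b * M)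
  have hvalue := mul_le_mul_of_nonneg_right ht.1
    (mul_nonneg hw₀.le (scaleValue_nonneg hq hQ.integrable_response (fun i => (hβ i).1) ht0))
  have herror : t * (θ * (2 * MY ^ 2 * (w₀ + (2 * MX) ^ q))) ≤
      b * (θ * (2 * MY ^ 2 * (w₀ + (2 * MX) ^ q))) :=
    mul_le_mul_of_nonneg_right ht.2 (by positivity)
  linarith

lemma mul_neg_objective_sub_le_objectiveSlope (hq : q = 1 ∨ q = 2) [IsFiniteMeasure μ]
    {a b : ℝ} (ha : 0 ≤ a) (hμ : ∀ᵐ t ∂μ, t ∈ Icc a b) (hQ : RegularPopulation Q MX MY v)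
    (hv : 0 < v) (hS : FullPredictivePower Q S) {l : Fin p} (hl : l ∉ S) {M : ℝ}
    (hβ : β ∈ feasibleSet p M) :
    a * weightBound p q MX v (b * M) * -objective q μ Q β -
        maximalCorrelation Q (subFeatures S) (subFeatures Sᶜ) *
          (b * (2 * MY ^ 2 * (weightBound p q MX v (b * M) + (2 * MX) ^ q)) * μ.real univ) ≤
      objectiveSlope q μ Q l β := by
  have := hQ.prob
  have hY := hQ.integrable_response
  have hβ0 i : 0 ≤ β i := (hβ i).1
  have hμ0 : ∀ᵐ t ∂μ, t ∈ Icc 0 b := hμ.mono fun t ht => ⟨ha.trans ht.1, ht.2⟩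
  have hvalue := (integrable_scaleValue (q := q) hY (hμ0.mono fun t ht => ht.1) hβ0).const_mul
    (a * weightBound p q MX v (b * M))
  have hmono := integral_mono_ae (hvalue.sub (integrable_const _))
    (integrable_mul_scaleSlope hQ.bounded_features hY hμ0 hβ0 l)
    (hμ.mono fun t ht => mul_scaleValue_sub_le_mul_scaleSlope hq hQ hv hS hl hβ ha ht)
  rw [integral_sub' hvalue (integrable_const _), integral_const_mul, integral_const, smul_eq_mul,
    ← objectiveSlope_eq_integral_mul_scaleSlope hQ.bounded_features hY hμ0 hβ0 l,
    ← neg_objective_eq_integral_scaleValue hY (hμ0.mono fun t ht => ht.1) hβ0] at hmono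
  linarith

end Population

/-! ### Recovery of the support -/

section Recovery

variable {F : EuclideanSpace ℝ (Fin p) → ℝ} {M : ℝ} {S : Finset (Fin p)}
  {β₀ : EuclideanSpace ℝ (Fin p)} {β : ℝ → EuclideanSpace ℝ (Fin p)}

lemma pos_of_coordSupport_eq_univ (hβ₀ : β₀ ∈ feasibleSet p M) (hsupp : coordSupport β₀ = univ)
    (i : Fin p) : 0 < β₀ i :=
  (hβ₀ i).1.lt_of_ne' (show i ∈ coordSupport β₀ from hsupp ▸ mem_univ i)

lemma coordSupport_nonempty_iff {x : EuclideanSpace ℝ (Fin p)} :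
    (coordSupport x).Nonempty ↔ x ≠ 0 := by
  simp only [coordSupport, Set.Nonempty, mem_ofPred_eq, ne_eq, PiLp.ext_iff, not_forall,
    PiLp.zero_apply]

lemma IsGradientFlow.coordSupport_nonempty (h : IsGradientFlow F (feasibleSet p M) β₀ β)
    (hF : ContDiff ℝ 1 F) (hlt : F β₀ < F 0) {t : ℝ} (ht : 0 ≤ t) :
    (coordSupport (β t)).Nonempty := by
  refine coordSupport_nonempty_iff.2 fun h0 => hlt.not_ge ?_
  simpa only [h0] using h.objective_le (isCompact_feasibleSet p M) (convex_feasibleSet p M) hF ht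

lemma IsGradientFlow.coordSupport_subset (h : IsGradientFlow F (feasibleSet p M) β₀ β)
    (hF : ContDiff ℝ 1 F) {c : ℝ} (hc : 0 < c)
    (hgrad : ∀ l ∉ S, ∀ x ∈ feasibleSet p M, F x ≤ F β₀ → c ≤ gradient F x l) {t : ℝ}
    (ht : 0 ≤ t) (htM : M / c < t) : coordSupport (β t) ⊆ S :=
  fun l hl => not_imp_comm.1 (fun hlS => h.coord_eq_zero hF l hc (hgrad l hlS) ht htM) hl

lemma RegularPopulation.exists_isCompact {Q : Measure (Obs p)} {MX MY v : ℝ}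
    (hQ : RegularPopulation Q MX MY v) : ∃ K, IsCompact K ∧ ∀ᵐ z ∂Q, z ∈ K := by
  refine ⟨(univ.pi fun _ => Icc (-MX) MX) ×ˢ Icc (-MY) MY,
    (isCompact_univ_pi fun _ => isCompact_Icc).prod isCompact_Icc, ?_⟩
  filter_upwards [hQ.bounded_features, hQ.bounded_response] with z hx hy
  exact ⟨fun i _ => abs_le.1 (hx i), abs_le.1 hy⟩

variable {q : ℕ} {μ : Measure ℝ} {Q : Measure (Obs p)}

lemma exists_mul_neg_objective_sub_le_objectiveSlope (p : ℕ) (hq : q = 1 ∨ q = 2)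
    (hμ : KernelMeasure μ) (M MX MY : ℝ) {v : ℝ} (hv : 0 < v) :
    ∃ γ C : ℝ, 0 < γ ∧ 0 < C ∧ ∀ Q : Measure (Obs p), RegularPopulation Q MX MY v →
      ∀ S, FullPredictivePower Q S → ∀ l ∉ S, ∀ β ∈ feasibleSet p M,
        γ * -objective q μ Q β - maximalCorrelation Q (subFeatures S) (subFeatures Sᶜ) * C ≤
          objectiveSlope q μ Q l β := by
  have := hμ.finite
  obtain ⟨a, b, ha, hab, hae⟩ := hμ.exists_bounds
  have hw₀ : 0 < weightBound p q |MX| v (b * M) := weightBound_pos (abs_nonneg MX) hv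
  set w₀ := weightBound p q |MX| v (b * M)
  set C := b * (2 * |MY| ^ 2 * (w₀ + (2 * |MX|) ^ q)) * μ.real univ
  have hb : 0 < b := ha.trans_le hab
  have hC : 0 ≤ C := by positivity
  refine ⟨a * w₀, C + 1, by positivity, add_pos_of_nonneg_of_pos hC one_pos,
    fun Q hQ S hS l hl β hβ => ?_⟩
  have hθ := maximalCorrelation_nonneg Q (subFeatures S) (subFeatures Sᶜ)
  have hslope := mul_neg_objective_sub_le_objectiveSlope hq ha.le hae
    (hQ.mono (le_abs_self MX) (le_abs_self MY)) hv hS hl hβ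
  linarith

lemma withExpHighProbability_coordSupport_gradientFlow (hμ : KernelMeasure μ)
    [IsProbabilityMeasure Q] {K : Set (Obs p)} (hK : IsCompact K) (hQK : ∀ᵐ z ∂Q, z ∈ K)
    (hc : ∫ z, z.2 ∂Q = 0) (hM : 0 ≤ M) (hβ₀ : β₀ ∈ feasibleSet p M)
    (hneg : objective q μ Q β₀ < 0) {γ : ℝ} (hγ : 0 < γ)
    (hslope : ∀ l ∉ S, ∀ x ∈ feasibleSet p M,
      γ * -objective q μ Q x - γ * |objective q μ Q β₀| / 4 ≤ objectiveSlope q μ Q l x) :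
    WithExpHighProbability Q fun _ z => ∀ β : ℝ → EuclideanSpace ℝ (Fin p),
      IsGradientFlow (objective q μ (empiricalMeasure z)) (feasibleSet p M) β₀ β →
      ∀ t, M / (γ * |objective q μ Q β₀| / 4) < t →
        (coordSupport (β t)).Nonempty ∧ coordSupport (β t) ⊆ (S : Set (Fin p)) := by
  have hF₀ : 0 < |objective q μ Q β₀| := abs_pos.2 hneg.ne
  have hF₀_eq : |objective q μ Q β₀| = -objective q μ Q β₀ := abs_of_neg hneg
  set F₀ := |objective q μ Q β₀|
  obtain ⟨ε, hε, hεF₀, hεγ⟩ : ∃ ε, 0 < ε ∧ ε ≤ F₀ / 8 ∧ ε ≤ γ * F₀ / 8 :=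
    ⟨min (F₀ / 8) (γ * F₀ / 8), by positivity, min_le_left _ _, min_le_right _ _⟩
  have hclose := withExpHighProbability_objective_close hK hQK hμ q (isCompact_feasibleSet p M) hε
  refine hclose.mono <| (eventually_ne_atTop 0).mono fun n hn z hz β hβ t htM => ?_
  have hF := contDiff_objective_empiricalMeasure z hμ hn q
  have ht : 0 ≤ t := le_trans (by positivity) htM.le
  have hstart := abs_le.1 (hz β₀ hβ₀).1
  refine ⟨hβ.coordSupport_nonempty hF ?_ ht,
    hβ.coordSupport_subset hF (by positivity) (fun l hl x hx hle => ?_) ht htM⟩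
  · have hzero := abs_le.1 (hz 0 fun _ => ⟨le_rfl, hM⟩).1
    rw [objective_zero q μ hc] at hzero
    linarith
  · have hvalue := abs_le.1 (hz x hx).1
    have hdecrease : γ * (F₀ * (3 / 4)) ≤ γ * -objective q μ Q x :=
      mul_le_mul_of_nonneg_left (by linarith) hγ.le
    have happrox := abs_le.1 ((hz x hx).2 l)
    rw [gradient_objective_empiricalMeasure z hμ hn q]
    linarith [hslope l hl x hx]

end Recovery

end MetricLearning

end

theorem mainTheorem7 (p q : ℕ) (hq : q = 1 ∨ q = 2) (M MX MY v : ℝ) (hM : 0 < M) (hv : 0 < v)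
    (μ : MeasureTheory.Measure ℝ) (hμ : MetricLearning.KernelMeasure μ) :
    ∃ κ : ℝ, 0 < κ ∧
      ∀ Q : MeasureTheory.Measure (MetricLearning.Obs p),
        MetricLearning.RegularPopulation Q MX MY v →
      ∀ S : Finset (Fin p), MetricLearning.FullPredictivePower Q S →
        ¬ MetricLearning.FullPredictivePower Q ∅ →
      ∀ β₀ : EuclideanSpace ℝ (Fin p), β₀ ∈ MetricLearning.feasibleSet p M →
        MetricLearning.coordSupport β₀ = Set.univ →
      0 < κ * |MetricLearning.objective q μ Q β₀| ∧
      (MetricLearning.maximalCorrelation Q (MetricLearning.subFeatures S)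
          (MetricLearning.subFeatures Sᶜ) ≤ κ * |MetricLearning.objective q μ Q β₀| →
        ∃ c τ : ℝ, 0 < c ∧ 0 < τ ∧ ∃ n₀ : ℕ, ∀ n : ℕ, n₀ ≤ n →
          ∃ A : Set (Fin n → MetricLearning.Obs p), MeasurableSet A ∧
            ENNReal.ofReal (1 - Real.exp (-(c * n))) ≤ MeasureTheory.Measure.pi (fun _ => Q) A ∧
            ∀ z ∈ A, ∀ β : ℝ → EuclideanSpace ℝ (Fin p),
              MetricLearning.IsGradientFlow
                (MetricLearning.objective q μ (MetricLearning.empiricalMeasure z))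
                (MetricLearning.feasibleSet p M) β₀ β →
              ∀ t, τ ≤ t → (MetricLearning.coordSupport (β t)).Nonempty ∧
                MetricLearning.coordSupport (β t) ⊆ (S : Set (Fin p))) := by
  open MetricLearning in
  obtain ⟨γ, C, hγ, hC, hslope⟩ :=
    exists_mul_neg_objective_sub_le_objectiveSlope p hq hμ M MX MY hv
  refine ⟨γ / (4 * C), by positivity, fun Q hQ S hS hE β₀ hβ₀ hsupp => ?_⟩
  have := hQ.prob
  have hneg : objective q μ Q β₀ < 0 := objective_neg_of_pos hq hμ hQ.integrable_response
    hQ.centered hE (pos_of_coordSupport_eq_univ hβ₀ hsupp)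
  have hF₀ : 0 < |objective q μ Q β₀| := abs_pos.2 hneg.ne
  refine ⟨by positivity, fun hθ => ?_⟩
  have hθC : maximalCorrelation Q (subFeatures S) (subFeatures Sᶜ) * C ≤
      γ * |objective q μ Q β₀| / 4 := by
    calc _ ≤ γ / (4 * C) * |objective q μ Q β₀| * C := by gcongr
      _ = γ * |objective q μ Q β₀| / 4 := by field_simp
  obtain ⟨K, hK, hQK⟩ := hQ.exists_isCompact
  obtain ⟨c, hc, n₀, hrecover⟩ :=
    (withExpHighProbability_coordSupport_gradientFlow hμ hK hQK hQ.centered hM.le hβ₀ hneg hγ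
      fun l hl x hx =>
        (sub_le_sub_left hθC _).trans (hslope Q hQ S hS l hl x hx)).exists_measurableSet
  refine ⟨c, M / (γ * |objective q μ Q β₀| / 4) + 1, hc, by positivity, n₀, fun n hn => ?_⟩
  obtain ⟨A, hA, hprob, hAz⟩ := hrecover n hn
  exact ⟨A, hA, hprob, fun z hz β hβ t ht => hAz z hz β hβ t (by linarith)⟩
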